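/- **Conventions.** For $m\ge 0$ put $\nu(m)=\lfloor (m+1)/2\rfloor$. For a finite-dimensional real vector space $V$ with a nondegenerate quadratic form $h$, let $\mathrm{Cl}(h)$ be the real Clifford algebra ($v^2=h(v)$), $\mathrm{Cl}^0(h)$ its even subalgebra and $\alpha$ its grading automorphism. A *spinor representation* of $\mathrm{Cl}(h)$, $m=\dim V$, is a representation in a complex vector space that is one of the following: a *Dirac* representation ($m$ even: faithful, irreducible, of complex dimension $2^{m/2}$); a *Pauli* representation ($m$ odd: its restriction to $\mathrm{Cl}^0(h)$ is faithful, irreducible, of complex dimension $2^{(m-1)/2}$); a *Cartan* representation ($m$ odd: equivalent to $\sigma\oplus\sigma\circ\alpha$ with $\sigma$ a Pauli representation). A *spin space* $(S,V,h)$ consists of a complex vector space $S$ of dimension $2^{\nu(\dim V)}$, a real subspace $V\subset\mathrm{End}_{\mathbb C}S$ and a nondegenerate quadratic form $h$ on $V$ with $v^2=h(v)\,\mathrm{id}_S$ for $v\in V$, such that the induced representation of $\mathrm{Cl}(h)$ in $S$ is a spinor representation (so it is Dirac if $\dim V$ is even, Cartan if $\dim V$ is odd). Its *Lipschitz group* is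 $\mathrm{Lpin}(h)=\{a\in \mathrm{GL}(S): aVa^{-1}=V\}$, a closed subgroup of $\mathrm{GL}(S)$; it acts on $V$ by the isometries $\mathrm{Ad}(a)v=ava^{-1}$ and on $S$ by the evaluation (spinor) representation $\theta$. Let $(M,g)$ be a smooth manifold with a smooth nondegenerate (not necessarily definite) metric $g$, $m=\dim M$. A *spinor bundle* on $(M,g)$ is a smooth complex vector bundle $\Sigma\to M$ with a smooth homomorphism of bundles of algebras $\tau:\mathrm{Cl}(g)\to\mathrm{End}\,\Sigma$ such that, for every $x$, $\tau_x:\mathrm{Cl}(g_x)\to\mathrm{End}\,\Sigma_x$ is a spinor representation; it is *faithful* if $\tau$ is injective. Let $(S,V,h)$ be a spin space such that $(V,h)$ is a local model of $(M,g)$: $(T_xM,g_x)$ is isometric to $(V,h)$ for every $x$. An *lpin structure* on $(M,g)$ is a smooth principal $\mathrm{Lpin}(h)$-bundle $Q\to M$ with a smooth map $\chi$, over the identity of $M$, to the bundle of orthonormal frames (isometries $(V,h)\to(T_xM,g_x)$) such that $\chi(qa)=\chi(q)\circ\mathrm{Ad}(a)$ for $q\in Q$, $a\in\mathrm{Lpin}(h)$.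 The associated bundle $Q\times_\theta S$ is the smooth complex vector bundle of classes $[(q,s)]$, where $[(qa,s)]=[(q,as)]$ for $a\in \mathrm{Lpin}(h)$, with the Clifford multiplication $\tau(X)[(q,s)]=[(q,\chi(q)^{-1}(X)s)]$ for $X\in T_xM$, $q\in Q_x$. **Theorem.** Let $(\Sigma,\tau)$ be a faithful spinor bundle on $(M,g)$ whose fibres have complex dimension $2^{\nu(m)}$, and let $(S,V,h)$ be a spin space such that $(V,h)$ is a local model of $(M,g)$. Then $\Sigma$ is isomorphic to the bundle associated, by the spinor representation, with an lpin structure on $(M,g)$. More precisely, let $$Q_x=\{q:S\to\Sigma_x \text{ a complex linear isomorphism}: qVq^{-1}=\tau(T_xM)\}$$ be the set of isomorphisms of the spin space $(S,V,h)$ onto $(\Sigma_x,T_xM,g_x)$, with the right action of $\mathrm{Lpin}(h)$ by composition. Then $Q=\bigcup_x Q_x$ is the total space of an lpin structure with $\chi(q):V\to T_xM$ determined by $\tau(\chi(q)v)=qvq^{-1}$, and $[(q,s)]\mapsto q(s)$ is an isomorphism of smooth complex vector bundles $Q\times_\theta S\to\Sigma$ that intertwines the Clifford multiplications by tangent vectors.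 -/

import Mathlib

open scoped Manifold ContDiff
open Bundle Module

noncomputable section

namespace SpinorBundles

/-! ### Spinor representations of real Clifford algebras -/

section Representations

/-- The integer part of `(m + 1) / 2`. -/
def nu (m : ℕ) : ℕ := (m + 1) / 2

variable {V : Type*} [AddCommGroup V] [Module ℝ V] (Q : QuadraticForm ℝ V)
variable {W : Type*} [AddCommGroup W] [Module ℂ W]

/-- Irreducibility of a representation of a real algebra in a complex vector space. -/
def IsIrreducibleRep {A : Type*} [Ring A] [Algebra ℝ A] (ρ : A →ₐ[ℝ] Module.End ℂ W) : Prop :=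
  Nontrivial W ∧
    ∀ U : Submodule ℂ W, (∀ (a : A) (w : W), w ∈ U → ρ a w ∈ U) → U = ⊥ ∨ U = ⊤

/-- Dirac representations: `dim V` is even, and the representation of `Cl(Q)` is faithful and
irreducible, of complex dimension `2 ^ (m / 2)`. -/
def IsDiracRep (ρ : CliffordAlgebra Q →ₐ[ℝ] Module.End ℂ W) : Prop :=
  Even (finrank ℝ V) ∧ Function.Injective ρ ∧ IsIrreducibleRep ρ ∧
    finrank ℂ W = 2 ^ (finrank ℝ V / 2)

/-- Extensions to `Cl(Q)` of the Pauli representation: `dim V` is odd, and the restriction to the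
even subalgebra is faithful and irreducible, of complex dimension `2 ^ ((m - 1) / 2)`. -/
def IsPauliRep (ρ : CliffordAlgebra Q →ₐ[ℝ] Module.End ℂ W) : Prop :=
  Odd (finrank ℝ V) ∧ Function.Injective (ρ.comp (CliffordAlgebra.even Q).val) ∧
    IsIrreducibleRep (ρ.comp (CliffordAlgebra.even Q).val) ∧
    finrank ℂ W = 2 ^ ((finrank ℝ V - 1) / 2)

/-- Cartan representations: `dim V` is odd, and the representation of `Cl(Q)` is equivalent to
`σ ⊕ (σ ∘ α)`, where `σ` is a Pauli representation and `α` is the grading automorphism. -/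
def IsCartanRep (ρ : CliffordAlgebra Q →ₐ[ℝ] Module.End ℂ W) : Prop :=
  Odd (finrank ℝ V) ∧
    ∃ σ : CliffordAlgebra Q →ₐ[ℝ] Module.End ℂ (Fin (2 ^ ((finrank ℝ V - 1) / 2)) → ℂ),
      IsPauliRep Q σ ∧
      ∃ φ : W ≃ₗ[ℂ] (Fin (2 ^ ((finrank ℝ V - 1) / 2)) → ℂ) ×
          (Fin (2 ^ ((finrank ℝ V - 1) / 2)) → ℂ),
        ∀ (a : CliffordAlgebra Q) (w : W),
          φ (ρ a w) = (σ a (φ w).1, σ (CliffordAlgebra.involute a) (φ w).2)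

/-- Spinor representations of `Cl(Q)`. -/
def IsSpinorRep (ρ : CliffordAlgebra Q →ₐ[ℝ] Module.End ℂ W) : Prop :=
  IsDiracRep Q ρ ∨ IsPauliRep Q ρ ∨ IsCartanRep Q ρ

end Representations

/-! ### Spin spaces and the Lipschitz group -/

section SpinSpaces

variable {S : Type*} [NormedAddCommGroup S] [NormedSpace ℂ S]

/-- The representation of `Cl(h)` in `S` extending the inclusion of a real space `V ⊆ End S`
that satisfies `v² = h(v) id`. -/
def evaluationRep (V : Submodule ℝ (S →L[ℂ] S)) (h : QuadraticForm ℝ V)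
    (sq_eq : ∀ v : V, (v : S →L[ℂ] S) * (v : S →L[ℂ] S) = h v • (1 : S →L[ℂ] S)) :
    CliffordAlgebra h →ₐ[ℝ] Module.End ℂ S :=
  CliffordAlgebra.lift h
    ⟨{ toFun := fun v => ((v : S →L[ℂ] S) : S →ₗ[ℂ] S)
       map_add' := fun _ _ => rfl
       map_smul' := fun _ _ => rfl },
      fun v => by
        ext s
        have := congrArg (fun T : S →L[ℂ] S => T s) (sq_eq v)
        simpa [Module.algebraMap_end_apply] using this⟩

/-- A spin space `(S, V, h)`: a real space `V ⊆ End S` with a nondegenerate quadratic form `h`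
such that `v² = h(v) id`, `dim_ℂ S = 2 ^ ν(dim V)`, and the resulting representation of `Cl(h)`
in `S` is a spinor representation (hence a Dirac one if `dim V` is even and a Cartan one if
`dim V` is odd). -/
structure SpinSpace (S : Type*) [NormedAddCommGroup S] [NormedSpace ℂ S] where
  V : Submodule ℝ (S →L[ℂ] S)
  h : QuadraticForm ℝ V
  nondegenerate : (QuadraticMap.polarBilin h).Nondegenerate
  sq_eq : ∀ v : V, (v : S →L[ℂ] S) * (v : S →L[ℂ] S) = h v • (1 : S →L[ℂ] S)
  finrank_eq : finrank ℂ S = 2 ^ nu (finrank ℝ V)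
  isSpinor : IsSpinorRep h (evaluationRep V h sq_eq)

namespace SpinSpace

variable (σ : SpinSpace S)

/-- The Lipschitz group `{a ∈ GL(S) | a V a⁻¹ = V}`. -/
def Lpin : Subgroup (S →L[ℂ] S)ˣ where
  carrier := {a | ∀ v : S →L[ℂ] S,
    v ∈ σ.V ↔ (a : S →L[ℂ] S) * v * ((a⁻¹ : (S →L[ℂ] S)ˣ) : S →L[ℂ] S) ∈ σ.V}
  one_mem' := by intro v; simp
  mul_mem' := by
    intro a b ha hb v
    rw [hb v, ha]
    simp only [Units.val_mul, mul_inv_rev, mul_assoc]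
  inv_mem' := by
    intro a ha v
    rw [ha (((a⁻¹ : (S →L[ℂ] S)ˣ) : S →L[ℂ] S) * v *
      ((a⁻¹⁻¹ : (S →L[ℂ] S)ˣ) : S →L[ℂ] S))]
    simp [mul_assoc]

/-- The Lipschitz group is closed in `GL(S)`. -/
theorem isClosed_Lpin : IsClosed (σ.Lpin : Set (S →L[ℂ] S)ˣ) := by
  have hS : FiniteDimensional ℂ S := by
    apply Module.finite_of_finrank_pos
    rw [σ.finrank_eq]; positivity
  have hE : FiniteDimensional ℝ (S →L[ℂ] S) := Module.Finite.trans ℂ _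
  have hV : IsClosed (σ.V : Set (S →L[ℂ] S)) := σ.V.closed_of_finiteDimensional
  have h : (σ.Lpin : Set (S →L[ℂ] S)ˣ) = ⋂ v : σ.V,
      ((fun a : (S →L[ℂ] S)ˣ => (a : S →L[ℂ] S) * v * ((a⁻¹ : (S →L[ℂ] S)ˣ) : S →L[ℂ] S)) ⁻¹'
        (σ.V : Set (S →L[ℂ] S))) ∩
      ((fun a : (S →L[ℂ] S)ˣ => ((a⁻¹ : (S →L[ℂ] S)ˣ) : S →L[ℂ] S) * v * (a : S →L[ℂ] S)) ⁻¹'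
        (σ.V : Set (S →L[ℂ] S))) := by
    ext a
    simp only [Set.mem_iInter, Set.mem_inter_iff, Set.mem_preimage, SetLike.mem_coe]
    constructor
    · intro ha v
      refine ⟨(ha v).1 v.2, (ha _).2 ?_⟩
      simp [mul_assoc]
    · intro ha v
      refine ⟨fun hv => (ha ⟨v, hv⟩).1, fun hv => ?_⟩
      simpa [mul_assoc] using (ha ⟨_, hv⟩).2
  rw [h]
  refine isClosed_iInter fun v => (hV.preimage ?_).inter (hV.preimage ?_)
  · exact (Units.continuous_val.mul continuous_const).mul Units.continuous_coe_inv
  · exact (Units.continuous_coe_inv.mul continuous_const).mul Units.continuous_val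

/-- The adjoint representation `Ad(a) v = a v a⁻¹` of the Lipschitz group in `(V, h)`. -/
def Ad (a : σ.Lpin) : σ.h.IsometryEquiv σ.h where
  toFun v := ⟨((a : (S →L[ℂ] S)ˣ) : S →L[ℂ] S) * v *
    (((a : (S →L[ℂ] S)ˣ)⁻¹ : (S →L[ℂ] S)ˣ) : S →L[ℂ] S), (a.2 v).1 v.2⟩
  map_add' v w := by ext1; simp [mul_add, add_mul]
  map_smul' c v := by ext1; simp
  invFun v := ⟨(((a : (S →L[ℂ] S)ˣ)⁻¹ : (S →L[ℂ] S)ˣ) : S →L[ℂ] S) * v *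
    ((a : (S →L[ℂ] S)ˣ) : S →L[ℂ] S), by
      rw [a.2]; simp [mul_assoc]⟩
  left_inv v := by ext1; simp [mul_assoc]
  right_inv v := by ext1; simp [mul_assoc]
  map_app' v := by
    have hS : Nontrivial S := by
      apply Module.nontrivial_of_finrank_pos (R := ℂ)
      rw [σ.finrank_eq]; positivity
    obtain ⟨s, hs⟩ := exists_ne (0 : S)
    set w : σ.V := ⟨((a : (S →L[ℂ] S)ˣ) : S →L[ℂ] S) * v *
      (((a : (S →L[ℂ] S)ˣ)⁻¹ : (S →L[ℂ] S)ˣ) : S →L[ℂ] S), (a.2 v).1 v.2⟩ with hw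
    have h1 := σ.sq_eq w
    have h2 : (w : S →L[ℂ] S) * w = σ.h v • (1 : S →L[ℂ] S) := by
      have : (w : S →L[ℂ] S) * w = ((a : (S →L[ℂ] S)ˣ) : S →L[ℂ] S) *
          ((v : S →L[ℂ] S) * v) *
          (((a : (S →L[ℂ] S)ˣ)⁻¹ : (S →L[ℂ] S)ˣ) : S →L[ℂ] S) := by
        simp [hw, mul_assoc]
      rw [this, σ.sq_eq v]; simp
    have h3 := congrArg (fun T : S →L[ℂ] S => T s) (h1.symm.trans h2)
    exact smul_left_injective ℝ hs (by simpa using h3)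

end SpinSpace

end SpinSpaces

/-! ### Principal bundles with structure group a subgroup of `GL(S)`, and associated bundles -/

section Principal

variable {S : Type*} [NormedAddCommGroup S] [NormedSpace ℂ S] (G : Subgroup (S →L[ℂ] S)ˣ)
variable {M : Type*} [TopologicalSpace M] (Q : M → Type*)
  [TopologicalSpace (TotalSpace G Q)] [∀ x, TopologicalSpace (Q x)] [FiberBundle G Q]
  [∀ x, MulAction Gᵐᵒᵖ (Q x)]

/-- A (topological) principal `G`-bundle: a fibre bundle with fibre `G`, with a right action of
`G` on the fibres, such that the local trivializations of the bundle atlas are `G`-equivariant. -/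
class IsPrincipalBundle : Prop where
  map_smul : ∀ (e : Trivialization G (π G Q)) [MemTrivializationAtlas e] (x : M),
    x ∈ e.baseSet → ∀ (q : Q x) (a : G), (e ⟨x, MulOpposite.op a • q⟩).2 = (e ⟨x, q⟩).2 * a

/-- A smooth principal `G`-bundle over a manifold: the transition functions of the bundle atlas
are smooth. Here `G` is a closed subgroup of `GL(S)`, and a map into `G` is smooth if and only if
it is smooth as a map into the vector space `End S`. -/
class IsSmoothPrincipalBundle {E : Type*} [NormedAddCommGroup E] [NormedSpace ℝ E]
    [ChartedSpace E M] [IsPrincipalBundle G Q] : Prop where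
  contMDiffOn_transition :
    ∀ (e e' : Trivialization G (π G Q)) [MemTrivializationAtlas e] [MemTrivializationAtlas e'],
      ContMDiffOn 𝓘(ℝ, E) 𝓘(ℝ, S →L[ℂ] S) ∞
        (fun x : M =>
          (((e' (e.toOpenPartialHomeomorph.symm (x, 1))).2 : (S →L[ℂ] S)ˣ) : S →L[ℂ] S))
        (e.baseSet ∩ e'.baseSet)

/-- The relation `(q, s) ≡ (q', s')` iff `q' = q a` and `s = a s'` for some `a ∈ G`. -/
def assocSetoid {M : Type*} (Q : M → Type*) [∀ x, MulAction Gᵐᵒᵖ (Q x)] (x : M) :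
    Setoid (Q x × S) where
  r p p' := ∃ a : G, p'.1 = MulOpposite.op a • p.1 ∧
    p.2 = ((a : (S →L[ℂ] S)ˣ) : S →L[ℂ] S) p'.2
  iseqv :=
    { refl := fun p => ⟨1, by simp⟩
      symm := by
        rintro p p' ⟨a, h1, h2⟩
        refine ⟨a⁻¹, ?_, ?_⟩
        · rw [h1, smul_smul, ← MulOpposite.op_mul]; simp
        · rw [h2, ← mul_apply_eq_comp, ← Units.val_mul, ← Subgroup.coe_mul]; simp
      trans := by
        rintro p p' p'' ⟨a, h1, h2⟩ ⟨b, h3, h4⟩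
        refine ⟨a * b, ?_, ?_⟩
        · rw [h3, h1, smul_smul, ← MulOpposite.op_mul]
        · rw [h2, h4]; simp }

/-- The fibre at `x` of the bundle `Q ×_θ S` associated with `Q` by the evaluation
representation `θ` of `G` in `S`: the set of all classes `[(q, s)]`. -/
def AssocBundle {M : Type*} (Q : M → Type*) [∀ x, MulAction Gᵐᵒᵖ (Q x)] (x : M) : Type _ :=
  Quotient (assocSetoid G Q x)

namespace AssocBundle

variable {G Q}

/-- The class `[(q, s)]`. -/
def mk {M : Type*} {Q : M → Type*} [∀ x, MulAction Gᵐᵒᵖ (Q x)] {x : M} (q : Q x) (s : S) :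
    AssocBundle G Q x :=
  Quotient.mk (assocSetoid G Q x) (q, s)

/-- The coordinate `e(q) s` of `[(q, s)]` with respect to a local trivialization `e` of `Q`. -/
def coord (e : Trivialization G (π G Q)) (x : M) (z : AssocBundle G Q x) : S :=
  (((e ⟨x, (Quotient.out z).1⟩).2 : (S →L[ℂ] S)ˣ) : S →L[ℂ] S) (Quotient.out z).2

variable [IsPrincipalBundle G Q]

lemma coord_mk (e : Trivialization G (π G Q)) [MemTrivializationAtlas e] {x : M}
    (hx : x ∈ e.baseSet) (q : Q x) (s : S) :
    coord e x (mk q s) = (((e ⟨x, q⟩).2 : (S →L[ℂ] S)ˣ) : S →L[ℂ] S) s := by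
  obtain ⟨a, h1, h2⟩ : (assocSetoid G Q x).r (Quotient.out (mk (G := G) q s)) (q, s) :=
    Quotient.exact (Quotient.out_eq (mk (G := G) q s))
  dsimp only at h1 h2
  have h3 := IsPrincipalBundle.map_smul e x hx (Quotient.out (mk (G := G) q s)).1 a
  rw [← h1] at h3
  rw [coord, h2, h3]
  simp

lemma exists_frame (e : Trivialization G (π G Q)) {x : M} (hx : x ∈ e.baseSet) (a : G) :
    ∃ q : Q x, e ⟨x, q⟩ = (x, a) ∧ e.toOpenPartialHomeomorph.symm (x, a) = ⟨x, q⟩ := by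
  have ht : (x, a) ∈ e.target := by rw [e.mem_target]; exact hx
  have h1 := e.apply_symm_apply ht
  have h2 := e.proj_symm_apply ht
  generalize e.toOpenPartialHomeomorph.symm (x, a) = p at h1 h2
  obtain ⟨y, q⟩ := p
  dsimp only at h2
  subst h2
  exact ⟨q, h1, rfl⟩

lemma exists_mk (e : Trivialization G (π G Q)) [MemTrivializationAtlas e] {x : M}
    (hx : x ∈ e.baseSet) {q : Q x} (hq : e ⟨x, q⟩ = (x, 1)) (z : AssocBundle G Q x) :
    ∃ s, z = mk q s := by
  obtain ⟨⟨q', s'⟩, rfl⟩ := Quotient.exists_rep z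
  refine ⟨(((e ⟨x, q'⟩).2 : (S →L[ℂ] S)ˣ) : S →L[ℂ] S) s', ?_⟩
  suffices h : q' = MulOpposite.op (e ⟨x, q'⟩).2 • q from
    (Quotient.sound (s := assocSetoid G Q x)
      (show (assocSetoid G Q x).r _ _ from ⟨(e ⟨x, q'⟩).2, h, rfl⟩)).symm
  have h1 : e ⟨x, q'⟩ = e ⟨x, MulOpposite.op (e ⟨x, q'⟩).2 • q⟩ := by
    apply Prod.ext
    · rw [e.coe_fst' (by exact hx), e.coe_fst' (by exact hx)]
    · rw [IsPrincipalBundle.map_smul e x hx, hq]; simp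
  have h2 := e.injOn (by rw [e.mem_source]; exact hx) (by rw [e.mem_source]; exact hx) h1
  simpa using h2

lemma coord_bijective (e : Trivialization G (π G Q)) [MemTrivializationAtlas e] {x : M}
    (hx : x ∈ e.baseSet) : Function.Bijective (coord (S := S) e x) := by
  obtain ⟨q, hq, -⟩ := exists_frame e hx 1
  constructor
  · intro z z' h
    obtain ⟨s, rfl⟩ := exists_mk e hx hq z
    obtain ⟨s', rfl⟩ := exists_mk e hx hq z'
    rw [coord_mk e hx, coord_mk e hx, hq] at h
    rw [show s = s' by simpa using h]
  · intro s
    exact ⟨mk q s, by rw [coord_mk e hx, hq]; simp⟩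

/-- The fibre of the associated bundle is identified with `S` by a local trivialization of `Q`. -/
def coordEquiv (x : M) : AssocBundle G Q x ≃ S :=
  Equiv.ofBijective (coord (trivializationAt G Q x) x)
    (coord_bijective _ (FiberBundle.mem_baseSet_trivializationAt G Q x))

instance (x : M) : AddCommGroup (AssocBundle G Q x) := (coordEquiv x).addCommGroup

instance (x : M) : Module ℂ (AssocBundle G Q x) := (coordEquiv x).module ℂ

instance (x : M) : TopologicalSpace (AssocBundle G Q x) :=
  TopologicalSpace.induced (coordEquiv x) inferInstance

/-- The vector space structure on the fibres satisfies `[(q, s)] + [(q, s')] = [(q, s + s')]`. -/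
lemma mk_add {x : M} (q : Q x) (s s' : S) :
    (mk q (s + s') : AssocBundle G Q x) = mk q s + mk q s' := by
  apply (coordEquiv x).injective
  have h := FiberBundle.mem_baseSet_trivializationAt G Q x
  rw [Equiv.add_def, Equiv.apply_symm_apply]
  change coord _ x _ = coord _ x _ + coord _ x _
  rw [coord_mk _ h, coord_mk _ h, coord_mk _ h, map_add]

/-- The vector space structure on the fibres satisfies `c [(q, s)] = [(q, c s)]`. -/
lemma mk_smul {x : M} (q : Q x) (c : ℂ) (s : S) :
    (mk q (c • s) : AssocBundle G Q x) = c • mk q s := by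
  apply (coordEquiv x).injective
  have h := FiberBundle.mem_baseSet_trivializationAt G Q x
  rw [Equiv.smul_def, Equiv.apply_symm_apply]
  change coord _ x _ = c • coord _ x _
  rw [coord_mk _ h, coord_mk _ h, map_smul]

/-- The local trivialization of `Q ×_θ S` induced by a local trivialization of `Q`. -/
def pretriv (e : Trivialization G (π G Q)) [MemTrivializationAtlas e] :
    Pretrivialization S (π S (AssocBundle G Q)) where
  toFun z := (z.1, coord e z.1 z.2)
  invFun p := ⟨(e.toOpenPartialHomeomorph.symm (p.1, 1)).1,
    mk (e.toOpenPartialHomeomorph.symm (p.1, 1)).2 p.2⟩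
  source := π S (AssocBundle G Q) ⁻¹' e.baseSet
  target := e.baseSet ×ˢ Set.univ
  map_source' z hz := ⟨hz, trivial⟩
  map_target' p hp := by
    obtain ⟨q, -, h⟩ := exists_frame e hp.1 1
    simpa [h] using hp.1
  left_inv' z hz := by
    obtain ⟨x, z⟩ := z
    have hx : x ∈ e.baseSet := hz
    obtain ⟨q, hq, h⟩ := exists_frame e hx 1
    obtain ⟨s, rfl⟩ := exists_mk e hx hq z
    dsimp only
    rw [h, coord_mk e hx, hq]
    simp
  right_inv' p hp := by
    obtain ⟨x, s⟩ := p
    obtain ⟨q, hq, h⟩ := exists_frame e (x := x) hp.1 1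
    dsimp only
    rw [h]
    dsimp only
    rw [coord_mk e hp.1, hq]
    simp
  open_target := e.open_baseSet.prod isOpen_univ
  baseSet := e.baseSet
  open_baseSet := e.open_baseSet
  source_eq := rfl
  target_eq := rfl
  proj_toFun _ _ := rfl

lemma pretriv_mk (e : Trivialization G (π G Q)) [MemTrivializationAtlas e] {x : M}
    (hx : x ∈ e.baseSet) (q : Q x) (s : S) :
    (pretriv (G := G) (Q := Q) e ⟨x, mk q s⟩).2 =
      (((e ⟨x, q⟩).2 : (S →L[ℂ] S)ˣ) : S →L[ℂ] S) s :=
  coord_mk e hx q s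

lemma pretriv_linear (e : Trivialization G (π G Q)) [MemTrivializationAtlas e] :
    (pretriv (S := S) e).IsLinear ℂ := by
  constructor
  intro x hx
  have hx' : x ∈ e.baseSet := hx
  obtain ⟨q, hq, -⟩ := exists_frame e hx' 1
  constructor
  · intro z z'
    obtain ⟨s, rfl⟩ := exists_mk e hx' hq z
    obtain ⟨s', rfl⟩ := exists_mk e hx' hq z'
    rw [← mk_add, pretriv_mk e hx', pretriv_mk e hx', pretriv_mk e hx', map_add]
  · intro c z
    obtain ⟨s, rfl⟩ := exists_mk e hx' hq z
    rw [← mk_smul, pretriv_mk e hx', pretriv_mk e hx', map_smul]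

lemma pretriv_coordChange (e e' : Trivialization G (π G Q)) [MemTrivializationAtlas e]
    [MemTrivializationAtlas e'] (x : M) (hx : x ∈ e.baseSet ∩ e'.baseSet) (s : S) :
    (((e' (e.toOpenPartialHomeomorph.symm (x, 1))).2 : (S →L[ℂ] S)ˣ) : S →L[ℂ] S) s =
      (pretriv (G := G) e' ⟨x, (pretriv (G := G) e).symm x s⟩).2 := by
  obtain ⟨q, hq, h⟩ := exists_frame e hx.1 1
  have h2 : (pretriv (G := G) e).symm x s = mk q s := by
    obtain ⟨s', hs'⟩ := exists_mk e hx.1 hq ((pretriv (G := G) e).symm x s)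
    have h3 := (pretriv (G := G) e).apply_mk_symm (b := x) hx.1 s
    have h4 := congrArg Prod.snd h3
    rw [hs', pretriv_mk e hx.1, hq] at h4
    rw [hs', show s' = s by simpa using h4]
  rw [h2, pretriv_mk e' hx.2, h]

variable (G Q) in
/-- The vector bundle structure of `Q ×_θ S`, given by the local trivializations
`[(q, s)] ↦ (x, e(q) s)`, where `e` runs over the bundle atlas of `Q`. -/
def prebundle : VectorPrebundle ℂ S (AssocBundle G Q) where
  pretrivializationAtlas := {p | ∃ (e : Trivialization G (π G Q))
    (_ : MemTrivializationAtlas e), p = pretriv e}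
  pretrivialization_linear' := by
    rintro _ ⟨e, _, rfl⟩
    exact pretriv_linear e
  pretrivializationAt x := pretriv (trivializationAt G Q x)
  mem_base_pretrivializationAt x := FiberBundle.mem_baseSet_trivializationAt G Q x
  pretrivialization_mem_atlas x := ⟨_, inferInstance, rfl⟩
  exists_coordChange := by
    rintro _ ⟨e, _, rfl⟩ _ ⟨e', _, rfl⟩
    refine ⟨_, ?_, pretriv_coordChange e e'⟩
    have h1 : ContinuousOn (fun x : M => e.toOpenPartialHomeomorph.symm (x, (1 : G)))
        (e.baseSet ∩ e'.baseSet) := by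
      refine e.toOpenPartialHomeomorph.continuousOn_symm.comp
        (Continuous.continuousOn (by fun_prop)) ?_
      intro x hx
      exact e.mem_target.2 hx.1
    have h2 : ContinuousOn (fun x : M => e' (e.toOpenPartialHomeomorph.symm (x, (1 : G))))
        (e.baseSet ∩ e'.baseSet) := by
      refine e'.continuousOn.comp h1 ?_
      intro x hx
      obtain ⟨q, -, h⟩ := exists_frame e hx.1 1
      have h2 : (⟨x, q⟩ : TotalSpace G Q) ∈ e'.source := e'.mem_source.2 hx.2
      rw [← h] at h2
      exact h2
    exact Units.continuous_val.comp_continuousOn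
      (continuous_subtype_val.comp_continuousOn (continuous_snd.comp_continuousOn h2))
  totalSpaceMk_isInducing x := by
    change Topology.IsInducing (fun z : AssocBundle G Q x => (x, coordEquiv x z))
    exact Topology.isInducing_const_prod.2 ⟨rfl⟩

instance : TopologicalSpace (TotalSpace S (AssocBundle G Q)) :=
  (prebundle G Q).totalSpaceTopology

instance : FiberBundle S (AssocBundle G Q) := (prebundle G Q).toFiberBundle

instance : VectorBundle ℂ S (AssocBundle G Q) := (prebundle G Q).toVectorBundle

end AssocBundle

end Principal

/-! ### Complex vector bundles over real manifolds -/

/-- A complex vector bundle is in particular a real vector bundle. -/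
instance vectorBundleReal {M F : Type*} [TopologicalSpace M] [NormedAddCommGroup F]
    [NormedSpace ℂ F] (Sig : M → Type*) [∀ x, AddCommGroup (Sig x)] [∀ x, Module ℂ (Sig x)]
    [∀ x, TopologicalSpace (Sig x)] [TopologicalSpace (TotalSpace F Sig)] [FiberBundle F Sig]
    [VectorBundle ℂ F Sig] : VectorBundle ℝ F Sig where
  trivialization_linear' e _ := by
    have h : e.IsLinear ℂ := inferInstance
    constructor
    intro x hx
    exact ⟨fun v w => (h.linear x hx).map_add v w,
      fun c v => by simpa using (h.linear x hx).map_smul (c : ℂ) v⟩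
  continuousOn_coordChange' e e' _ _ := by
    have h := (ContinuousLinearMap.restrictScalarsL ℂ F F ℝ ℝ).continuous.comp_continuousOn
      (continuousOn_coordChange ℂ e e')
    refine h.congr fun x hx => ?_
    ext v
    have h1 : e.IsLinear ℝ := ⟨fun x hx => ⟨fun v w => ((trivialization_linear ℂ e).linear x hx).map_add v w,
      fun c v => by simpa using ((trivialization_linear ℂ e).linear x hx).map_smul (c : ℂ) v⟩⟩
    have h2 : e'.IsLinear ℝ := ⟨fun x hx => ⟨fun v w => ((trivialization_linear ℂ e').linear x hx).map_add v w,
      fun c v => by simpa using ((trivialization_linear ℂ e').linear x hx).map_smul (c : ℂ) v⟩⟩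
    simp [Trivialization.coordChangeL_apply _ _ hx]

section SmoothAssoc

variable {E : Type*} [NormedAddCommGroup E] [NormedSpace ℝ E]
  {M : Type*} [TopologicalSpace M] [ChartedSpace E M]

/-- The bundle associated with a smooth principal bundle is a smooth vector bundle. -/
theorem AssocBundle.contMDiffVectorBundle {S : Type*} [NormedAddCommGroup S] [NormedSpace ℂ S]
    (G : Subgroup (S →L[ℂ] S)ˣ) (Q : M → Type*)
    [TopologicalSpace (TotalSpace G Q)] [∀ x, TopologicalSpace (Q x)] [FiberBundle G Q]
    [∀ x, MulAction Gᵐᵒᵖ (Q x)] [IsPrincipalBundle G Q]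
    [hQ : IsSmoothPrincipalBundle G Q (E := E)] :
    ContMDiffVectorBundle ∞ S (AssocBundle G Q) 𝓘(ℝ, E) where
  contMDiffOn_coordChangeL := by
    intro t t' ht ht'
    have hl : t.IsLinear ℝ := trivialization_linear ℝ t
    have hl' : t'.IsLinear ℝ := trivialization_linear ℝ t'
    obtain ⟨_, ⟨e, he, rfl⟩, rfl⟩ := ht.out
    obtain ⟨_, ⟨e', he', rfl⟩, rfl⟩ := ht'.out
    have h := hQ.contMDiffOn_transition e e'
    have h' := (ContinuousLinearMap.restrictScalarsL ℂ S S ℝ ℝ).contMDiff.comp_contMDiffOn h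
    refine h'.congr fun x hx => ?_
    ext s
    rw [ContinuousLinearEquiv.coe_coe]
    refine (Trivialization.coordChangeL_apply (R := ℝ) (F := S) (E := AssocBundle G Q) _ _ hx s).trans ?_
    exact (pretriv_coordChange e e' x hx s).symm

/-- Isomorphisms of smooth complex vector bundles over `M` (covering the identity). -/
structure SmoothBundleIso (F₁ : Type*) [NormedAddCommGroup F₁] [NormedSpace ℂ F₁]
    (B₁ : M → Type*) [∀ x, AddCommGroup (B₁ x)] [∀ x, Module ℂ (B₁ x)]
    [∀ x, TopologicalSpace (B₁ x)] [TopologicalSpace (TotalSpace F₁ B₁)] [FiberBundle F₁ B₁]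
    (F₂ : Type*) [NormedAddCommGroup F₂] [NormedSpace ℂ F₂]
    (B₂ : M → Type*) [∀ x, AddCommGroup (B₂ x)] [∀ x, Module ℂ (B₂ x)]
    [∀ x, TopologicalSpace (B₂ x)] [TopologicalSpace (TotalSpace F₂ B₂)] [FiberBundle F₂ B₂] where
  equiv : ∀ x, B₁ x ≃ₗ[ℂ] B₂ x
  contMDiff_equiv : ContMDiff (𝓘(ℝ, E).prod 𝓘(ℝ, F₁)) (𝓘(ℝ, E).prod 𝓘(ℝ, F₂)) ∞
    (fun p : TotalSpace F₁ B₁ => (⟨p.1, equiv p.1 p.2⟩ : TotalSpace F₂ B₂))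
  contMDiff_symm : ContMDiff (𝓘(ℝ, E).prod 𝓘(ℝ, F₂)) (𝓘(ℝ, E).prod 𝓘(ℝ, F₁)) ∞
    (fun p : TotalSpace F₂ B₂ => (⟨p.1, (equiv p.1).symm p.2⟩ : TotalSpace F₁ B₁))

end SmoothAssoc

/-! ### Riemannian manifolds of arbitrary signature and bundles of Clifford modules -/

section Geometry

variable {E : Type*} [NormedAddCommGroup E] [NormedSpace ℝ E]
  {M : Type*} [TopologicalSpace M] [ChartedSpace E M] [IsManifold 𝓘(ℝ, E) ∞ M]

variable (E M) in
/-- A smooth nondegenerate, not necessarily definite, metric tensor field. -/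
structure MetricField where
  inner (x : M) : TangentSpace 𝓘(ℝ, E) x →L[ℝ] TangentSpace 𝓘(ℝ, E) x →L[ℝ] ℝ
  symm (x : M) (v w : TangentSpace 𝓘(ℝ, E) x) : inner x v w = inner x w v
  nondegenerate (x : M) (v : TangentSpace 𝓘(ℝ, E) x) : (∀ w, inner x v w = 0) → v = 0
  contMDiff : ContMDiff 𝓘(ℝ, E) (𝓘(ℝ, E).prod 𝓘(ℝ, E →L[ℝ] E →L[ℝ] ℝ)) ∞
    (fun x : M => TotalSpace.mk' (E →L[ℝ] E →L[ℝ] ℝ) x (inner x))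

/-- The quadratic form `g_x(v) = g_x(v, v)` on `T_x M`. -/
def MetricField.quad (g : MetricField E M) (x : M) : QuadraticForm ℝ (TangentSpace 𝓘(ℝ, E) x) :=
  LinearMap.BilinMap.toQuadraticMap
    (LinearMap.mk₂ ℝ (fun v w => g.inner x v w) (by simp) (by simp) (by simp) (by simp))

/-- Smoothness on `U` of a vector field. -/
def SmoothField (X : ∀ x : M, TangentSpace 𝓘(ℝ, E) x) (U : Set M) : Prop :=
  ContMDiffOn 𝓘(ℝ, E) (𝓘(ℝ, E).prod 𝓘(ℝ, E)) ∞
    (fun x : M => (⟨x, X x⟩ : TotalSpace E (TangentSpace 𝓘(ℝ, E) : M → Type _))) U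

section Modules

variable (F : Type*) [NormedAddCommGroup F] [NormedSpace ℂ F]
  (Sig : M → Type*) [∀ x, AddCommGroup (Sig x)] [∀ x, Module ℂ (Sig x)]
  [∀ x, TopologicalSpace (Sig x)] [TopologicalSpace (TotalSpace F Sig)] [FiberBundle F Sig]

variable (E) {Sig} in
/-- Smoothness on `U` of a section of `Sig`. -/
def SmoothSection (s : ∀ x : M, Sig x) (U : Set M) : Prop :=
  ContMDiffOn 𝓘(ℝ, E) (𝓘(ℝ, E).prod 𝓘(ℝ, F)) ∞
    (fun x : M => (⟨x, s x⟩ : TotalSpace F Sig)) U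

/-- The structure `τ : Cl(g) → End Sig` of a bundle of Clifford modules on a smooth complex vector
bundle: a homomorphism of bundles of algebras. Since `TM` generates `Cl(g)`, smoothness of `τ`
means that `τ(X) s` is smooth for all smooth local vector fields `X` and sections `s`. -/
structure CliffordModuleBundle (g : MetricField E M) where
  rep : ∀ x, CliffordAlgebra (g.quad x) →ₐ[ℝ] Module.End ℂ (Sig x)
  smooth : ∀ U : Set M, IsOpen U → ∀ (X : ∀ x : M, TangentSpace 𝓘(ℝ, E) x) (s : ∀ x, Sig x),
    SmoothField X U → SmoothSection E F s U →
      SmoothSection E F (fun x => rep x (CliffordAlgebra.ι (g.quad x) (X x)) (s x)) U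

variable {F Sig} {g : MetricField E M} (τ : CliffordModuleBundle F Sig g)

/-- Clifford multiplication by a tangent vector. -/
def CliffordModuleBundle.clifford (x : M) (X : TangentSpace 𝓘(ℝ, E) x) :
    Module.End ℂ (Sig x) :=
  τ.rep x (CliffordAlgebra.ι (g.quad x) X)

/-- Spinor bundles: the representation of `Cl(g_x)` is a spinor representation for every `x`. -/
def CliffordModuleBundle.IsSpinorBundle : Prop := ∀ x, IsSpinorRep (g.quad x) (τ.rep x)

/-- `τ` is injective. -/
def CliffordModuleBundle.IsFaithful : Prop := ∀ x, Function.Injective (τ.rep x)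

/-- The set of isomorphisms of the spin space `(S, V, h)` onto `(Sig_x, T_x M, g_x)`, where `T_x M`
is identified with its image in `End Sig_x`: complex linear isomorphisms `q : S → Sig_x` such that
`q V q⁻¹ = τ(T_x M)`. -/
def SpinIso {S : Type*} [NormedAddCommGroup S] [NormedSpace ℂ S] (σ : SpinSpace S)
    (τ : CliffordModuleBundle F Sig g) (x : M) : Type _ :=
  {q : S ≃ₗ[ℂ] Sig x //
    Set.range (fun v : σ.V => q.conj ((v : S →L[ℂ] S) : S →ₗ[ℂ] S)) = Set.range (τ.clifford x)}

/-- The right action of the Lipschitz group on spin space isomorphisms by composition. -/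
instance {S : Type*} [NormedAddCommGroup S] [NormedSpace ℂ S] (σ : SpinSpace S)
    (τ : CliffordModuleBundle F Sig g) (x : M) : MulAction (σ.Lpin)ᵐᵒᵖ (SpinIso σ τ x) where
  smul a q := ⟨(ContinuousLinearEquiv.unitsEquiv ℂ S
      (a.unop : (S →L[ℂ] S)ˣ)).toLinearEquiv.trans q.1, by
    refine Eq.trans ?_ q.2
    ext A
    constructor
    · rintro ⟨v, rfl⟩
      refine ⟨σ.Ad a.unop v, ?_⟩
      rfl
    · rintro ⟨v, rfl⟩
      obtain ⟨w, rfl⟩ := (σ.Ad a.unop).toLinearEquiv.surjective v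
      exact ⟨w, rfl⟩⟩
  one_smul q := by apply Subtype.ext; ext s; rfl
  mul_smul a b q := by apply Subtype.ext; ext s; rfl

end Modules

section Lpin

variable {S : Type*} [NormedAddCommGroup S] [NormedSpace ℂ S] (σ : SpinSpace S)
  (g : MetricField E M) (Q : M → Type*)
  [TopologicalSpace (TotalSpace σ.Lpin Q)] [∀ x, TopologicalSpace (Q x)] [FiberBundle σ.Lpin Q]
  [∀ x, MulAction (σ.Lpin)ᵐᵒᵖ (Q x)]

/-- Orthonormal frames at `x`: isometries of `(V, h)` onto `(T_x M, g_x)`. -/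
abbrev OrthonormalFrame (x : M) : Type _ := σ.h.IsometryEquiv (g.quad x)

/-- An lpin structure: a reduction `χ` of the bundle of orthonormal frames to a smooth principal
`Lpin(h)`-bundle `Q`, with `χ(q a) = χ(q) ∘ Ad(a)`. A local section of the bundle of orthonormal
frames is smooth if all the vector fields of the frame are smooth; so `χ` is smooth if and only if
it maps the local sections of `Q` given by local trivializations to smooth frames. -/
structure LpinStructure [IsPrincipalBundle σ.Lpin Q] : Type _ where
  smooth : IsSmoothPrincipalBundle σ.Lpin Q (E := E)
  χ : ∀ x, Q x → OrthonormalFrame σ g x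
  χ_smul : ∀ (x : M) (q : Q x) (a : σ.Lpin) (v : σ.V),
    χ x (MulOpposite.op a • q) v = χ x q (σ.Ad a v)
  χ_smooth : ∀ (e : Trivialization σ.Lpin (π σ.Lpin Q)) [MemTrivializationAtlas e]
    (q : ∀ x, Q x), (∀ x ∈ e.baseSet, e ⟨x, q x⟩ = (x, 1)) →
    ∀ v : σ.V, SmoothField (fun x => χ x (q x) v) e.baseSet

variable {σ g Q}

/-- Clifford multiplication on the bundle associated with an lpin structure:
`τ(X) [(q, s)] = [(q, χ(q)⁻¹(X) s)]`. -/
def LpinStructure.clifford [IsPrincipalBundle σ.Lpin Q] (L : LpinStructure σ g Q) (x : M)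
    (X : TangentSpace 𝓘(ℝ, E) x) : AssocBundle σ.Lpin Q x → AssocBundle σ.Lpin Q x :=
  Quotient.map (sa := assocSetoid σ.Lpin Q x) (sb := assocSetoid σ.Lpin Q x)
    (fun p => (p.1, (((L.χ x p.1).toLinearEquiv.symm X : σ.V) : S →L[ℂ] S) p.2)) (by
      rintro ⟨q, s⟩ ⟨q', s'⟩ ⟨a, h1, h2⟩
      dsimp only at h1 h2
      subst h1 h2
      refine ⟨a, rfl, ?_⟩
      dsimp only
      obtain ⟨v, hv⟩ := (L.χ x (MulOpposite.op a • q)).toLinearEquiv.surjective X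
      have h3 : (L.χ x q).toLinearEquiv (σ.Ad a v) = X := by
        rw [← hv]; exact (L.χ_smul x q a v).symm
      have h4 : (L.χ x q).toLinearEquiv.symm X = σ.Ad a v := by
        rw [← h3]; exact LinearEquiv.symm_apply_apply _ _
      have h5 : (L.χ x (MulOpposite.op a • q)).toLinearEquiv.symm X = v := by
        rw [← hv]; exact LinearEquiv.symm_apply_apply _ _
      rw [h4, h5]
      change ((((a : (S →L[ℂ] S)ˣ) : S →L[ℂ] S) * v *
        (((a : (S →L[ℂ] S)ˣ)⁻¹ : (S →L[ℂ] S)ˣ) : S →L[ℂ] S)) *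
          ((a : (S →L[ℂ] S)ˣ) : S →L[ℂ] S)) s' = _
      rw [Units.inv_mul_cancel_right]
      rfl)

end Lpin

end Geometry

end SpinorBundles

end

open SpinorBundles

noncomputable section

namespace SpinorBundles

/-! ### Equivalence of Clifford systems on spaces of the same dimension -/

/-! Two isomorphisms q, p of the spin space onto the same fibre differ by q⁻¹p, which normalizes V
and so lies in Lpin(h). Each Q_x is therefore a torsor, and everything except the existence of
smooth local sections of Q is formal. Given such sections, the transition functions q⁻¹p are smooth
because they can be computed in a trivialization of Σ; χ(q) is well defined because nondegeneracy of
g makes τ injective on tangent vectors; and in the coordinates induced by a section q, the map [(q,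
s)] ↦ q(s) is the section itself.

Sections are found in two steps. The first is algebra at one point. An orthogonal basis of V acts by
anticommuting operators with prescribed nonzero squares. Over ℂ such a system of even length is
determined up to equivalence by the dimension of the space (`IsCliffordSystem.exists_intertwiner`):
its last two members split the space into two copies of a space carrying a shorter system. In odd
length this fails, but for odd m the dimension 2^ν(m) forces the representation to be a Cartan one,
and the exchange of its two summands is one more anticommuting involution, which makes the length
even. Hence every isometry V → T_xM lifts to an isomorphism S → Σ_x (`exists_intertwiner`).

The second step spreads this over a neighbourhood. An orthonormal frame at x₀ extends to a smooth
one (`MetricField.exists_smooth_orthonormal_frame`). The lift at x₀, taken constant in a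
trivialization of Σ, is averaged over the Clifford systems of the frame. The average depends
smoothly on the point, intertwines the systems (`average_intertwines`), is unchanged at x₀
(`average_eq_self`), and hence stays invertible near x₀ (`hasSmoothSpinFrames`). -/

/-- The first `n` terms of the sequence `a` anticommute, and have the squares `c i`. -/
structure IsCliffordSystem {A : Type*} [Ring A] [Algebra ℂ A] (n : ℕ) (c : ℕ → ℂ)
    (a : ℕ → A) : Prop where
  anticomm : ∀ i < n, ∀ j < n, i ≠ j → a i * a j = -(a j * a i)
  sq : ∀ i < n, a i * a i = algebraMap ℂ A (c i)

/-- Two anticommuting involutions `a`, `b` identify `W` with two copies of the eigenspace of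
the involution `I a b`. -/
theorem exists_splitting {W : Type*} [AddCommGroup W] [Module ℂ W] {a b : Module.End ℂ W}
    (ha : a * a = 1) (hb : b * b = 1) (hab : a * b = -(b * a)) :
    ∃ (P : Submodule ℂ W) (e : W ≃ₗ[ℂ] P × P),
      (∀ d : Module.End ℂ W, a * d = -(d * a) → b * d = -(d * b) → ∀ w ∈ P, d w ∈ P) ∧
      (∀ p, e.symm p = (p.1 : W) + a p.2) ∧
      (∀ p, b (e.symm p) = Complex.I • (p.2 : W) - Complex.I • a p.1) := by
  have haa : ∀ w, a (a w) = w := fun w => LinearMap.congr_fun ha w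
  have hbb : ∀ w, b (b w) = w := fun w => LinearMap.congr_fun hb w
  have habw : ∀ w, a (b w) = -b (a w) := fun w => LinearMap.congr_fun hab w
  -- This c is an involution anticommuting with a, so a exchanges its eigenspaces for 1 and -1, and
  -- W = P ⊕ aP with P the first of them. An operator that anticommutes with both a and b commutes
  -- with c and preserves P; and b = -I a c gives the formula for b.
  set c : Module.End ℂ W := Complex.I • (a * b) with hc
  have hcw : ∀ w, c w = Complex.I • a (b w) := fun w => rfl
  have hI : ∀ w : W, Complex.I • Complex.I • w = -w := fun w => by
    rw [smul_smul, Complex.I_mul_I, neg_one_smul]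
  have hcc : ∀ w, c (c w) = w := fun w => by
    rw [hcw, hcw, map_smul, map_smul, hI, habw (a (b w)), haa, hbb, neg_neg]
  have hca : ∀ w, c (a w) = -a (c w) := fun w => by
    rw [hcw, hcw, map_smul, haa, habw, haa, smul_neg]
  have hcb : ∀ w, b w = -(Complex.I • a (c w)) := fun w => by
    rw [hcw, map_smul, haa, hI, neg_neg]
  let P : Submodule ℂ W := LinearMap.ker (c - 1)
  have hP : ∀ w, w ∈ P ↔ c w = w := fun w => by
    simp [P, LinearMap.mem_ker, sub_eq_zero]
  let p : W →ₗ[ℂ] P := LinearMap.codRestrict P ((1 / 2 : ℂ) • (1 + c)) fun w => by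
    rw [hP]; simp [hcc, add_comm]
  have hp : ∀ w, (p w : W) = (1 / 2 : ℂ) • (w + c w) := fun w => rfl
  have hpP : ∀ w : P, p w = w := fun w => by
    ext; rw [hp, (hP w).1 w.2, ← two_smul ℂ (w : W), smul_smul]; norm_num
  have hpa : ∀ w : P, p (a w) = 0 := fun w => by
    ext; rw [hp, hca, (hP w).1 w.2]; simp
  let e : W ≃ₗ[ℂ] P × P := LinearEquiv.ofLinearMap (p.prod (p ∘ₗ a))
    (LinearMap.coprod P.subtype (a ∘ₗ P.subtype))
    (by ext w <;> simp [hpP, hpa, haa])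
    (by
      ext w
      simp only [LinearMap.comp_apply, LinearMap.prod_apply, Function.prod_apply, LinearMap.coprod_apply,
        Submodule.subtype_apply, hp, LinearMap.id_apply, map_smul, map_add, hca, haa, map_neg]
      rw [← smul_add]
      have : w + c w + (w + -c w) = (2 : ℂ) • w := by rw [two_smul]; abel
      rw [this, smul_smul]; norm_num)
  have he : ∀ q, e.symm q = (q.1 : W) + a q.2 := fun q => rfl
  refine ⟨P, e, fun d hd1 hd2 w hw => ?_, he, fun q => ?_⟩
  · rw [hP] at hw ⊢
    have h1 : ∀ w, a (d w) = -d (a w) := fun w => LinearMap.congr_fun hd1 w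
    have h2 : ∀ w, b (d w) = -d (b w) := fun w => LinearMap.congr_fun hd2 w
    rw [hcw, h2, map_neg, h1, neg_neg, ← map_smul, ← hcw, hw]
  · rw [he, map_add, hcb, hcb, hca, (hP q.1).1 q.1.2, (hP q.2).1 q.2.2, map_neg, haa]
    simp [add_comm, sub_eq_add_neg]

/-- Induction on the number of pairs. The last pair splits each space as P ⊕ aP; the earlier
operators anticommute with that pair, so they restrict to P and give a system with one pair fewer on
a space of half the dimension. An equivalence φ on P extends by u + a v ↦ φ u + b φ v, and the
splitting formulas show that it intertwines the last pair as well. The spaces are quantified after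
`k` so that the induction hypothesis applies to the subspaces. -/
theorem exists_intertwiner_of_involutions (k : ℕ) : ∀ {W₁ : Type*} {W₂ : Type*}
    [AddCommGroup W₁] [Module ℂ W₁] [AddCommGroup W₂] [Module ℂ W₂]
    [FiniteDimensional ℂ W₁] [FiniteDimensional ℂ W₂] (a : ℕ → Module.End ℂ W₁)
    (b : ℕ → Module.End ℂ W₂),
    IsCliffordSystem (2 * k) 1 a → IsCliffordSystem (2 * k) 1 b →
    finrank ℂ W₁ = finrank ℂ W₂ →
    ∃ φ : W₁ ≃ₗ[ℂ] W₂, ∀ i < 2 * k, ∀ w, φ (a i w) = b i (φ w) := by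
  induction k with
  | zero =>
    intro W₁ W₂ _ _ _ _ _ _ a b _ _ h
    exact ⟨LinearEquiv.ofFinrankEq _ _ h, fun i hi => absurd hi (by simp)⟩
  | succ k ih =>
    intro W₁ W₂ _ _ _ _ _ _ a b ha hb h
    obtain ⟨P₁, e₁, hd₁, he₁, hf₁⟩ := exists_splitting (a := a (2 * k)) (b := a (2 * k + 1))
      (by simpa using ha.sq (2 * k) (by lia)) (by simpa using ha.sq (2 * k + 1) (by lia))
      (ha.anticomm _ (by lia) _ (by lia) (by lia))
    obtain ⟨P₂, e₂, hd₂, he₂, hf₂⟩ := exists_splitting (a := b (2 * k)) (b := b (2 * k + 1))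
      (by simpa using hb.sq (2 * k) (by lia)) (by simpa using hb.sq (2 * k + 1) (by lia))
      (hb.anticomm _ (by lia) _ (by lia) (by lia))
    have hP : finrank ℂ P₁ = finrank ℂ P₂ := by
      have h1 := e₁.finrank_eq
      have h2 := e₂.finrank_eq
      rw [finrank_prod] at h1 h2
      lia
    have hi₁ : ∀ i < 2 * k, ∀ w ∈ P₁, a i w ∈ P₁ := fun i hi => hd₁ _
      (ha.anticomm _ (by lia) _ (by lia) (by lia)) (ha.anticomm _ (by lia) _ (by lia) (by lia))
    have hi₂ : ∀ i < 2 * k, ∀ w ∈ P₂, b i w ∈ P₂ := fun i hi => hd₂ _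
      (hb.anticomm _ (by lia) _ (by lia) (by lia)) (hb.anticomm _ (by lia) _ (by lia) (by lia))
    -- Preservation of P is known only for indices below 2k; the value 0 elsewhere is a filler.
    let a' : ℕ → Module.End ℂ P₁ := fun i =>
      if hi : i < 2 * k then (a i).restrict (hi₁ i hi) else 0
    let b' : ℕ → Module.End ℂ P₂ := fun i =>
      if hi : i < 2 * k then (b i).restrict (hi₂ i hi) else 0
    have ha' : ∀ i < 2 * k, ∀ w, (a' i w : W₁) = a i w := fun i hi w => by
      simp only [a', dif_pos hi]; rfl
    have hb' : ∀ i < 2 * k, ∀ w, (b' i w : W₂) = b i w := fun i hi w => by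
      simp only [b', dif_pos hi]; rfl
    obtain ⟨φ, hφ⟩ := ih a' b'
      ⟨fun i hi j hj hij => by
          ext w
          simpa [ha' i hi, ha' j hj] using
            LinearMap.congr_fun (ha.anticomm i (by lia) j (by lia) hij) w,
        fun i hi => by
          ext w
          simpa [ha' i hi] using LinearMap.congr_fun (ha.sq i (by lia)) w⟩
      ⟨fun i hi j hj hij => by
          ext w
          simpa [hb' i hi, hb' j hj] using
            LinearMap.congr_fun (hb.anticomm i (by lia) j (by lia) hij) w,
        fun i hi => by
          ext w
          simpa [hb' i hi] using LinearMap.congr_fun (hb.sq i (by lia)) w⟩ hP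
    let ψ : W₁ ≃ₗ[ℂ] W₂ := e₁.trans ((φ.prodCongr φ).trans e₂.symm)
    have hψ : ∀ u v : P₁, ψ (u + a (2 * k) v) = φ u + b (2 * k) (φ v) := fun u v => by
      rw [← he₁ (u, v)]
      simp [ψ, he₂]
    have haa : ∀ w, a (2 * k) (a (2 * k) w) = w := fun w => by
      simpa using LinearMap.congr_fun (ha.sq (2 * k) (by lia)) w
    have hbb : ∀ w, b (2 * k) (b (2 * k) w) = w := fun w => by
      simpa using LinearMap.congr_fun (hb.sq (2 * k) (by lia)) w
    refine ⟨ψ, fun i hi w => ?_⟩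
    obtain ⟨⟨u, v⟩, rfl⟩ := e₁.symm.surjective w
    have hw : ψ (e₁.symm (u, v)) = e₂.symm (φ u, φ v) := by simp [ψ]
    rcases lt_or_ge i (2 * k) with hi' | hi'
    · have h1 : ∀ w, a i (a (2 * k) w) = -a (2 * k) (a i w) := fun w =>
        LinearMap.congr_fun (ha.anticomm i hi (2 * k) (by lia) (by lia)) w
      have h2 : ∀ w, b i (b (2 * k) w) = -b (2 * k) (b i w) := fun w =>
        LinearMap.congr_fun (hb.anticomm i hi (2 * k) (by lia) (by lia)) w
      have h3 := hψ (a' i u) (-(a' i v))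
      rw [hw, he₁, he₂]
      simp only [map_add, h1, h2, ← ha' i hi', ← hb' i hi', ← hφ i hi']
      simpa using h3
    · rcases Nat.lt_or_ge (2 * k) i with hi'' | hi''
      · obtain rfl : i = 2 * k + 1 := by lia
        rw [hw, hf₁, hf₂]
        have h3 := hψ (Complex.I • v) (-(Complex.I • u))
        simp only [Submodule.coe_smul, Submodule.coe_neg, map_neg, map_smul,
          ← sub_eq_add_neg] at h3
        exact h3
      · obtain rfl : i = 2 * k := by lia
        have h3 := hψ v u
        rw [hw, he₁, he₂, map_add (a (2 * k)), map_add (b (2 * k)), haa, hbb, add_comm, h3,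
          add_comm]

/-- Every nonzero complex number has a square root, so rescaling turns all squares into 1. This is
why the signature of the metric plays no role. -/
theorem IsCliffordSystem.normalize {A : Type*} [Ring A] [Algebra ℂ A] {n : ℕ} {c : ℕ → ℂ}
    {a : ℕ → A} (ha : IsCliffordSystem n c a) {d : ℕ → ℂ} (hd0 : ∀ i < n, d i ≠ 0)
    (hd : ∀ i < n, c i = d i * d i) : IsCliffordSystem n 1 (fun i => (d i)⁻¹ • a i) where
  anticomm i hi j hj hij := by
    rw [smul_mul_smul_comm, smul_mul_smul_comm, ha.anticomm i hi j hj hij, smul_neg, mul_comm]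
  sq i hi := by
    have := hd0 i hi
    rw [smul_mul_smul_comm, ha.sq i hi, hd i hi, Algebra.algebraMap_eq_smul_one, smul_smul,
      show (d i)⁻¹ * (d i)⁻¹ * (d i * d i) = 1 by field_simp]
    simp

/-- Two Clifford systems of the same even length, with the same squares, on spaces of the same
dimension are equivalent. -/
theorem IsCliffordSystem.exists_intertwiner {n : ℕ} (hn : Even n) {W₁ : Type*} {W₂ : Type*}
    [AddCommGroup W₁] [Module ℂ W₁] [AddCommGroup W₂] [Module ℂ W₂]
    [FiniteDimensional ℂ W₁] [FiniteDimensional ℂ W₂] {c : ℕ → ℂ} {a : ℕ → Module.End ℂ W₁}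
    {b : ℕ → Module.End ℂ W₂} (ha : IsCliffordSystem n c a) (hb : IsCliffordSystem n c b)
    (hc : ∀ i < n, c i ≠ 0) (h : finrank ℂ W₁ = finrank ℂ W₂) :
    ∃ φ : W₁ ≃ₗ[ℂ] W₂, ∀ i < n, ∀ w, φ (a i w) = b i (φ w) := by
  obtain ⟨k, rfl⟩ := hn.two_dvd
  choose d hd using fun i => IsAlgClosed.exists_pow_nat_eq (c i) two_pos
  replace hd : ∀ i, c i = d i * d i := fun i => by rw [← hd, pow_two]
  have hd0 : ∀ i < 2 * k, d i ≠ 0 := fun i hi h0 => hc i hi (by rw [hd, h0, zero_mul])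
  obtain ⟨φ, hφ⟩ := exists_intertwiner_of_involutions k _ _ (ha.normalize hd0 fun i _ => hd i) (hb.normalize hd0 fun i _ => hd i) h
  refine ⟨φ, fun i hi w => ?_⟩
  have h1 := hφ i hi w
  simp only [LinearMap.smul_apply, map_smul] at h1
  exact smul_right_injective _ (inv_ne_zero (hd0 i hi)) h1

/-! ### Smooth families of complex linear maps -/

section Smooth

variable {S F G : Type*} [NormedAddCommGroup S] [NormedSpace ℂ S] [NormedAddCommGroup F]
  [NormedSpace ℂ F] [NormedAddCommGroup G] [NormedSpace ℂ G]
  {E : Type*} [NormedAddCommGroup E] [NormedSpace ℝ E]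
  {H : Type*} [TopologicalSpace H] {I : ModelWithCorners ℝ E H}
  {M : Type*} [TopologicalSpace M] [ChartedSpace H M] {U : Set M}

/-- The base is a real manifold and the fibres are complex, so operations that are smooth over ℂ are
used here after restriction of scalars to ℝ. -/
theorem contMDiffOn_clm_comp {A : M → F →L[ℂ] G} {B : M → S →L[ℂ] F}
    (hA : ContMDiffOn I 𝓘(ℝ, F →L[ℂ] G) ∞ A U) (hB : ContMDiffOn I 𝓘(ℝ, S →L[ℂ] F) ∞ B U) :
    ContMDiffOn I 𝓘(ℝ, S →L[ℂ] G) ∞ (fun x => A x ∘L B x) U :=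
  ((isBoundedBilinearMap_comp (𝕜 := ℂ) (E := S) (F := F) (G := G)).contDiff.restrict_scalars
    ℝ).contMDiff.comp_contMDiffOn (hA.prodMk_space hB)

theorem contMDiffOn_clm_apply_complex {A : M → F →L[ℂ] G} {v : M → F}
    (hA : ContMDiffOn I 𝓘(ℝ, F →L[ℂ] G) ∞ A U) (hv : ContMDiffOn I 𝓘(ℝ, F) ∞ v U) :
    ContMDiffOn I 𝓘(ℝ, G) ∞ (fun x => A x (v x)) U :=
  ((isBoundedBilinearMap_apply (𝕜 := ℂ) (E := F) (F := G)).contDiff.restrict_scalars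
    ℝ).contMDiff.comp_contMDiffOn (hA.prodMk_space hv)

theorem contMDiffOn_complex_smul (z : ℂ) {v : M → F} (hv : ContMDiffOn I 𝓘(ℝ, F) ∞ v U) :
    ContMDiffOn I 𝓘(ℝ, F) ∞ (fun x => z • v x) U :=
  ((contDiff_const_smul (𝕜 := ℂ) (F := F) z).restrict_scalars ℝ).contMDiff.comp_contMDiffOn hv

theorem contMDiffOn_clm_inverse [CompleteSpace F] {A : M → F →L[ℂ] G}
    (hA : ContMDiffOn I 𝓘(ℝ, F →L[ℂ] G) ∞ A U) (hA' : ∀ x ∈ U, (A x).IsInvertible) :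
    ContMDiffOn I 𝓘(ℝ, G →L[ℂ] F) ∞ (fun x => (A x).inverse) U := by
  intro x hx
  obtain ⟨e, he⟩ := hA' x hx
  have h := (contDiffAt_map_inverse (𝕜 := ℂ) (n := ∞) e).restrict_scalars ℝ
  rw [he] at h
  exact h.contMDiffAt.comp_contMDiffWithinAt x (hA x hx)

end Smooth

/-- A family of linear maps on a finite-dimensional space is smooth if it is so on vectors. -/
theorem contMDiffOn_clm_of_apply {𝕜 : Type*} [RCLike 𝕜] {S F : Type*} [NormedAddCommGroup S]
    [NormedSpace 𝕜 S] [FiniteDimensional 𝕜 S] [NormedAddCommGroup F] [NormedSpace 𝕜 F]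
    [NormedSpace ℝ F] [IsScalarTower ℝ 𝕜 F]
    {E : Type*} [NormedAddCommGroup E] [NormedSpace ℝ E] {H : Type*} [TopologicalSpace H]
    {I : ModelWithCorners ℝ E H} {M : Type*} [TopologicalSpace M] [ChartedSpace H M] {U : Set M}
    {A : M → S →L[𝕜] F} (hA : ∀ s, ContMDiffOn I 𝓘(ℝ, F) ∞ (fun x => A x s) U) :
    ContMDiffOn I 𝓘(ℝ, S →L[𝕜] F) ∞ A U := by
  let b := finBasis 𝕜 S
  -- In a basis, A x is a finite sum of rank-one maps, each the image of the vector A x (b i) under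
  -- a fixed continuous linear map.
  have h : ∀ x, A x = ∑ i, (b.coord i).toContinuousLinearMap.smulRight (A x (b i)) := fun x => by
    ext s
    have h1 := congrArg (A x) (b.sum_repr s)
    rw [map_sum] at h1
    simpa only [map_smul, sum_apply, ContinuousLinearMap.smulRight_apply,
      LinearMap.coe_toContinuousLinearMap', Basis.coord_apply] using h1.symm
  rw [funext h]
  refine contMDiffOn_finsetSum fun i _ => ?_
  let R : F →L[𝕜] S →L[𝕜] F :=
    ContinuousLinearMap.smulRightL 𝕜 S F (b.coord i).toContinuousLinearMap
  exact (R.restrictScalars ℝ).contMDiff.comp_contMDiffOn (hA (b i))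

/-! ### Averaging a linear map to an intertwiner of Clifford systems -/

section Average

variable {S F : Type*} [NormedAddCommGroup S] [NormedSpace ℂ S] [NormedAddCommGroup F]
  [NormedSpace ℂ F]

/-- The average of `T` over the first `n` terms of two Clifford systems with the squares `c i`. -/
def average (c : ℕ → ℂ) (a : ℕ → S →L[ℂ] S) (b : ℕ → F →L[ℂ] F) (T : S →L[ℂ] F) :
    ℕ → S →L[ℂ] F
  | 0 => T
  -- For nonzero c n, the map T ↦ (c n)⁻¹ b T a is an involution whose fixed points are the T with b
  -- T = T a; half of its sum with the identity projects onto them.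
  | n + 1 => (1 / 2 : ℂ) • (average c a b T n + (c n)⁻¹ • (b n ∘L average c a b T n ∘L a n))

variable {c : ℕ → ℂ} {a : ℕ → S →L[ℂ] S} {b : ℕ → F →L[ℂ] F} {T : S →L[ℂ] F}

/-- An intertwiner is fixed by each of the projections. At the base point this keeps the given
isomorphism. -/
theorem average_eq_self {n : ℕ} (ha : IsCliffordSystem n c a) (hc : ∀ i < n, c i ≠ 0)
    (hT : ∀ i < n, b i ∘L T = T ∘L a i) : average c a b T n = T := by
  suffices h : ∀ k ≤ n, average c a b T k = T from h n le_rfl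
  intro k hk
  induction k with
  | zero => rfl
  | succ k ih =>
    have h1 : a k ∘L a k = c k • ContinuousLinearMap.id ℂ S := by
      exact (ha.sq k hk).trans (Algebra.algebraMap_eq_smul_one _)
    rw [average, ih (by lia), ← ContinuousLinearMap.comp_assoc, hT k hk,
      ContinuousLinearMap.comp_assoc, h1, ContinuousLinearMap.comp_smul,
      inv_smul_smul₀ (hc k hk), ContinuousLinearMap.comp_id, ← two_smul ℂ T, smul_smul]
    norm_num

/-- The newest projection makes the map intertwine the newest pair, since b k and a k exchange its
two terms. It does not spoil the earlier pairs: moving b i past b k and a i past a k produces two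
signs that cancel. -/
theorem average_intertwines {n : ℕ} (ha : IsCliffordSystem n c a) (hb : IsCliffordSystem n c b)
    (hc : ∀ i < n, c i ≠ 0) :
    ∀ i < n, b i ∘L average c a b T n = average c a b T n ∘L a i := by
  suffices h : ∀ k ≤ n, ∀ i < k, b i ∘L average c a b T k = average c a b T k ∘L a i from
    h n le_rfl
  intro k hk
  induction k with
  | zero => simp
  | succ k ih =>
    intro i hi
    set A := average c a b T k with hA
    have hb' : ∀ i < n, ∀ w, b i (b i w) = c i • w := fun i hi w => by
      simpa [Algebra.algebraMap_eq_smul_one] using DFunLike.congr_fun (hb.sq i hi) w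
    have ha' : ∀ i < n, ∀ w, a i (a i w) = c i • w := fun i hi w => by
      simpa [Algebra.algebraMap_eq_smul_one] using DFunLike.congr_fun (ha.sq i hi) w
    ext s
    simp only [average, ContinuousLinearMap.comp_apply, smul_apply,
      add_apply, map_smul, map_add, ← hA]
    congr 1
    rcases Nat.lt_succ_iff_lt_or_eq.1 hi with hi' | rfl
    · have h1 : b i (b k (A (a k s))) = -b k (b i (A (a k s))) :=
        DFunLike.congr_fun (hb.anticomm i (by lia) k (by lia) (by lia)) _
      have h2 : a k (a i s) = -a i (a k s) :=
        DFunLike.congr_fun (ha.anticomm k (by lia) i (by lia) (by lia)) _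
      have h3 : ∀ s, b i (A s) = A (a i s) := fun s =>
        DFunLike.congr_fun (ih (by lia) i hi') s
      rw [h1, h2, h3, h3, map_neg, map_neg]
    · rw [hb' i (by lia), ha' i (by lia), map_smul, map_smul, inv_smul_smul₀ (hc i (by lia)),
        inv_smul_smul₀ (hc i (by lia)), add_comm]

theorem contMDiffOn_average {E : Type*} [NormedAddCommGroup E] [NormedSpace ℝ E]
    {M : Type*} [TopologicalSpace M] [ChartedSpace E M] {U : Set M}
    {b : M → ℕ → F →L[ℂ] F} (T : S →L[ℂ] F) (n : ℕ)
    (hb : ∀ i < n, ContMDiffOn 𝓘(ℝ, E) 𝓘(ℝ, F →L[ℂ] F) ∞ (fun x => b x i) U) :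
    ContMDiffOn 𝓘(ℝ, E) 𝓘(ℝ, S →L[ℂ] F) ∞ (fun x => average c a (b x) T n) U := by
  induction n with
  | zero => exact contMDiffOn_const
  | succ n ih =>
    have ih := ih fun i hi => hb i (by lia)
    have h2 : ContMDiffOn 𝓘(ℝ, E) 𝓘(ℝ, S →L[ℂ] F) ∞
        (fun x => b x n ∘L average c a (b x) T n ∘L a n) U :=
      contMDiffOn_clm_comp (hb n (by lia)) (contMDiffOn_clm_comp ih contMDiffOn_const)
    exact contMDiffOn_complex_smul _ (ih.add (contMDiffOn_complex_smul _ h2))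

end Average

/-! ### Clifford systems of spinor representations -/

section Spinor

variable {V : Type*} [AddCommGroup V] [Module ℝ V] {Q : QuadraticForm ℝ V}
variable {W : Type*} [AddCommGroup W] [Module ℂ W]

/-- In a spinor representation of an odd-dimensional Clifford algebra in a space of the dimension
of the Cartan representation, there is an involution that anticommutes with all vectors. -/
theorem IsSpinorRep.exists_anticommuting_involution {ρ : CliffordAlgebra Q →ₐ[ℝ] Module.End ℂ W}
    (hρ : IsSpinorRep Q ρ) (hW : finrank ℂ W = 2 ^ nu (finrank ℝ V)) (hV : Odd (finrank ℝ V)) :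
    ∃ t : Module.End ℂ W, t * t = 1 ∧
      ∀ v, ρ (CliffordAlgebra.ι Q v) * t = -(t * ρ (CliffordAlgebra.ι Q v)) := by
  rcases hρ with h | h | ⟨-, σ, -, φ, hφ⟩
  · exact absurd h.1 (Nat.not_even_iff_odd.2 hV)
  -- A Pauli representation has dimension 2^((m-1)/2), half of the required 2^((m+1)/2).
  · have h1 := hW.symm.trans h.2.2.2
    have h2 := Nat.pow_right_injective le_rfl h1
    obtain ⟨k, hk⟩ := hV
    rw [nu] at h2
    lia
  -- A vector acts by σ(v) on the first summand and by σ(α(v)) = -σ(v) on the second, so the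
  -- exchange of the summands anticommutes with it.
  · let s := LinearEquiv.prodComm ℂ (Fin (2 ^ ((finrank ℝ V - 1) / 2)) → ℂ)
      (Fin (2 ^ ((finrank ℝ V - 1) / 2)) → ℂ)
    have hs : ∀ p, s p = (p.2, p.1) := fun p => rfl
    refine ⟨(φ.trans (s.trans φ.symm) : W ≃ₗ[ℂ] W), ?_, fun v => ?_⟩
    · ext w
      simp [hs]
    · ext w
      apply φ.injective
      simp [hφ, hs]

/-- Polarization: orthogonality, written as additivity of Q, removes the cross terms from the square
of ρ(e i + e j). The target is an arbitrary complex algebra so as to cover both algebraic and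
continuous endomorphisms. -/
theorem isCliffordSystem_ι {A : Type*} [Ring A] [Algebra ℂ A] (ρ : V → A)
    (hadd : ∀ v w, ρ (v + w) = ρ v + ρ w)
    (hρ : ∀ v, ρ v * ρ v = algebraMap ℂ A (Q v : ℂ)) {n : ℕ} {e : ℕ → V}
    (he : ∀ i < n, ∀ j < n, i ≠ j → Q (e i + e j) = Q (e i) + Q (e j)) :
    IsCliffordSystem n (fun i => (Q (e i) : ℂ)) (fun i => ρ (e i)) where
  anticomm i hi j hj hij := by
    have h1 := hρ (e i + e j)
    rw [he i hi j hj hij, hadd, add_mul, mul_add, mul_add, hρ, hρ, Complex.ofReal_add,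
      map_add] at h1
    rw [eq_neg_iff_add_eq_zero]
    have h2 : ∀ x y z w : A, x + y + (z + w) = x + w → y + z = 0 := fun x y z w h => by
      have : y + z = (x + y + (z + w)) - (x + w) := by abel
      rw [this, h, sub_self]
    exact h2 _ _ _ _ h1
  sq i _ := hρ (e i)

theorem IsCliffordSystem.snoc {A : Type*} [Ring A] [Algebra ℂ A] {n : ℕ} {c : ℕ → ℂ} {a : ℕ → A}
    (ha : IsCliffordSystem n c a) {t : A} (ht : t * t = 1) (hta : ∀ i < n, a i * t = -(t * a i)) :
    IsCliffordSystem (n + 1) (fun i => if i < n then c i else 1)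
      (fun i => if i < n then a i else t) where
  anticomm i hi j hj hij := by
    split_ifs with h1 h2 h2
    · exact ha.anticomm i h1 j h2 hij
    · exact hta i h1
    · rw [hta j h2, neg_neg]
    · lia
  sq i hi := by
    split_ifs with h
    · exact ha.sq i h
    · rw [ht, map_one]

/-- Spinor representations of dimension `2 ^ ν(m)` of Clifford algebras of isometric quadratic
spaces are equivalent on orthogonal vectors. -/
theorem IsSpinorRep.exists_intertwiner {V' W' : Type*} [AddCommGroup V'] [Module ℝ V']
    {Q' : QuadraticForm ℝ V'} [AddCommGroup W'] [Module ℂ W']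
    {ρ : CliffordAlgebra Q →ₐ[ℝ] Module.End ℂ W} {ρ' : CliffordAlgebra Q' →ₐ[ℝ] Module.End ℂ W'}
    (hρ : IsSpinorRep Q ρ) (hρ' : IsSpinorRep Q' ρ')
    (hW : finrank ℂ W = 2 ^ nu (finrank ℝ V)) (hW' : finrank ℂ W' = 2 ^ nu (finrank ℝ V'))
    (f : Q.IsometryEquiv Q') (e : ℕ → V)
    (he : ∀ i < finrank ℝ V, ∀ j < finrank ℝ V, i ≠ j → Q (e i + e j) = Q (e i) + Q (e j))
    (he0 : ∀ i < finrank ℝ V, Q (e i) ≠ 0) :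
    ∃ φ : W ≃ₗ[ℂ] W', ∀ i < finrank ℝ V, ∀ w,
      φ (ρ (CliffordAlgebra.ι Q (e i)) w) = ρ' (CliffordAlgebra.ι Q' (f (e i))) (φ w) := by
  have : FiniteDimensional ℂ W := Module.finite_of_finrank_pos (by rw [hW]; positivity)
  have : FiniteDimensional ℂ W' := Module.finite_of_finrank_pos (by rw [hW']; positivity)
  have hf : finrank ℝ V = finrank ℝ V' := f.toLinearEquiv.finrank_eq
  have hWW : finrank ℂ W = finrank ℂ W' := by rw [hW, hW', hf]
  have hA := isCliffordSystem_ι (Q := Q) (A := Module.End ℂ W)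
    (fun v => ρ (CliffordAlgebra.ι Q v)) (by simp)
    (fun v => by rw [← map_mul, CliffordAlgebra.ι_sq_scalar, AlgHom.commutes]; rfl) he
  have hB := isCliffordSystem_ι (Q := Q) (A := Module.End ℂ W')
    (fun v => ρ' (CliffordAlgebra.ι Q' (f v))) (by simp)
    (fun v => by
      rw [← map_mul, CliffordAlgebra.ι_sq_scalar, AlgHom.commutes, f.map_app]; rfl) he
  rcases Nat.even_or_odd (finrank ℝ V) with hV | hV
  · exact hA.exists_intertwiner hV hB (fun i hi => by simpa using he0 i hi) hWW
  -- The involutions t and t' bring the length to the even number m + 1. That φ also intertwines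
  -- them is then discarded.
  · obtain ⟨t, ht, hta⟩ := hρ.exists_anticommuting_involution hW hV
    obtain ⟨t', ht', hta'⟩ := hρ'.exists_anticommuting_involution hW' (hf ▸ hV)
    obtain ⟨φ, hφ⟩ := (hA.snoc ht fun i _ => hta (e i)).exists_intertwiner
      (Odd.add_one hV) (hB.snoc ht' fun i _ => hta' (f (e i)))
      (fun i hi => by
        split_ifs with h
        · simpa using he0 i h
        · exact one_ne_zero) hWW
    refine ⟨φ, fun i hi w => ?_⟩
    simpa [hi] using hφ i (by lia) w

end Spinor

/-! ### Smooth orthonormalization of bilinear forms -/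

section SquareRoot

open Filter
open scoped Topology

/-- Near the identity, square roots in a Banach algebra exist, are unique, and depend analytically
on the argument. -/
theorem exists_local_sqrt (A : Type*) [NormedRing A] [NormedAlgebra ℝ A] [CompleteSpace A] :
    ∃ R : A → A, R 1 = 1 ∧ ContDiffAt ℝ ω R 1 ∧ (∀ᶠ y in 𝓝 1, R y * R y = y) ∧
      ∀ᶠ x in 𝓝 1, R (x * x) = x := by
  have hsq : ContDiff ℝ ω (fun x : A => x * x) := contDiff_id.mul contDiff_id
  -- The derivative of squaring at 1 is multiplication by 2, which is invertible; R is the local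
  -- inverse given by the inverse function theorem.
  let L : A ≃L[ℝ] A := ContinuousLinearEquiv.smulLeft (Units.mk0 (2 : ℝ) two_ne_zero)
  have hd : HasStrictFDerivAt (fun x : A => x * x) (L : A →L[ℝ] A) 1 := by
    convert! (hasStrictFDerivAt_id (𝕜 := ℝ) (1 : A)).mul' (hasStrictFDerivAt_id (𝕜 := ℝ) (1 : A))
      using 1
    ext y
    simp [L, two_smul]
  have h1 := hd.eventually_right_inverse
  have h2 := hd.eventually_left_inverse
  have h3 := (hsq.contDiffAt (x := 1)).to_localInverse hd.hasFDerivAt (by simp)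
  have h4 := hd.localInverse_apply_image
  simp only [mul_one] at h1 h3 h4
  exact ⟨_, h4, h3, h1, h2⟩

variable {E : Type*} [NormedAddCommGroup E] [NormedSpace ℝ E] [FiniteDimensional ℝ E]

set_option synthInstance.maxHeartbeats 200000 in
/-- Symmetric bilinear forms near a nondegenerate symmetric form `β` are transformed to `β` by
automorphisms that depend smoothly on the form. -/
theorem exists_smooth_orthonormalization (β : E →L[ℝ] E →L[ℝ] ℝ) (hβ : ∀ v w, β v w = β w v)
    (hβ' : ∀ v, (∀ w, β v w = 0) → v = 0) :
    ∃ (N : Set (E →L[ℝ] E →L[ℝ] ℝ)) (A : (E →L[ℝ] E →L[ℝ] ℝ) → E →L[ℝ] E), IsOpen N ∧ β ∈ N ∧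
      ContDiffOn ℝ ∞ A N ∧ A β = 1 ∧
      ∀ G ∈ N, (∀ v w, G v w = G w v) → ∀ v w, G (A G v) (A G w) = β v w := by
  -- Gram–Schmidt could meet isotropic vectors. Instead write G(v, w) = β(B v, w) and take A =
  -- B^(-1/2), the square root near 1. Then A is β-selfadjoint and commutes with B, so G(A v, A w) =
  -- β(A B A v, w) = β(v, w).
  obtain ⟨R, hR1, hRd, hRsq, hRu⟩ := exists_local_sqrt (E →L[ℝ] E)
  have hinj : Function.Injective β.toLinearMap := by
    rw [← LinearMap.ker_eq_bot, LinearMap.ker_eq_bot']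
    intro v hv
    exact hβ' v fun w => by simpa using DFunLike.congr_fun hv w
  have hfr : finrank ℝ E = finrank ℝ (E →L[ℝ] ℝ) := by
    rw [← (LinearMap.toContinuousLinearMap (𝕜 := ℝ) (E := E) (F' := ℝ)).finrank_eq]
    exact (Subspace.dual_finrank_eq (K := ℝ) (V := E)).symm
  let b : E ≃L[ℝ] (E →L[ℝ] ℝ) :=
    (LinearEquiv.ofInjectiveOfFinrankEq β.toLinearMap hinj hfr).toContinuousLinearEquiv
  have hb : ∀ v, b v = β v := fun v => rfl
  have hb' : ∀ (l : E →L[ℝ] ℝ) w, β (b.symm l) w = l w := fun l w => by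
    rw [← hb, b.apply_symm_apply]
  let B : (E →L[ℝ] E →L[ℝ] ℝ) →L[ℝ] (E →L[ℝ] E) :=
    ContinuousLinearMap.compL ℝ E (E →L[ℝ] ℝ) E (b.symm : (E →L[ℝ] ℝ) →L[ℝ] E)
  have hB : ∀ G v w, β (B G v) w = G v w := fun G v w => hb' _ _
  have hBβ : B β = 1 := by
    ext v
    exact b.symm_apply_apply v
  -- The adjoint with respect to β, an anti-automorphism of the algebra of endomorphisms.
  let adj : (E →L[ℝ] E) → (E →L[ℝ] E) := fun T =>
    B ((ContinuousLinearMap.compL ℝ E E ℝ).flip T ∘L β)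
  have hadj : ∀ T v w, β (adj T v) w = β v (T w) := fun T v w => hb' _ _
  have hadjc : Continuous adj := by
    refine B.continuous.comp ?_
    exact (((ContinuousLinearMap.compL ℝ E (E →L[ℝ] ℝ) (E →L[ℝ] ℝ)).flip β).continuous).comp
      ((ContinuousLinearMap.compL ℝ E E ℝ).flip.continuous)
  have hext : ∀ u v, (∀ w, β u w = β v w) → u = v := fun u v h => by
    rw [← sub_eq_zero]
    exact hβ' _ fun w => by simp [h w]
  have hadj1 : adj 1 = 1 := by
    ext v
    exact hext _ _ fun w => by rw [hadj]; rfl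
  have hadjm : ∀ T U, adj (T * U) = adj U * adj T := fun T U => by
    ext v
    refine hext _ _ fun w => ?_
    rw [hadj, mul_apply_eq_comp, mul_apply_eq_comp, hadj, hadj]
  let C : (E →L[ℝ] E →L[ℝ] ℝ) → (E →L[ℝ] E) := fun G => Ring.inverse (B G)
  have hCβ : C β = 1 := by simp only [C, hBβ, Ring.inverse_one]
  have hBd : ContDiff ℝ ω (B : (E →L[ℝ] E →L[ℝ] ℝ) → (E →L[ℝ] E)) :=
    contDiff_const.clm_comp contDiff_id
  have hCd : ContDiffAt ℝ ω C β := by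
    have hinv : ContDiffAt ℝ ω (Ring.inverse : (E →L[ℝ] E) → (E →L[ℝ] E)) (B β) := by
      rw [hBβ]
      exact contDiffAt_ringInverse ℝ (1 : (E →L[ℝ] E)ˣ)
    exact hinv.comp β hBd.contDiffAt
  let A : (E →L[ℝ] E →L[ℝ] ℝ) → (E →L[ℝ] E) := fun G => R (C G)
  have hAβ : A β = 1 := by simp only [A, hCβ, hR1]
  have hAd : ContDiffAt ℝ ω A β := by
    have h : ContDiffAt ℝ ω R (C β) := by rw [hCβ]; exact hRd
    exact h.comp β hCd
  have hCt : Tendsto C (𝓝 β) (𝓝 1) := hCβ ▸ hCd.continuousAt.tendsto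
  have hAt : Tendsto (fun G => adj (A G)) (𝓝 β) (𝓝 1) := by
    have h := (hadjc.continuousAt.comp hAd.continuousAt).tendsto
    simp only [Function.comp_def, hAβ, hadj1] at h
    exact h
  have hBt : Tendsto B (𝓝 β) (𝓝 1) := hBβ ▸ B.continuous.tendsto β
  have hunit : ∀ᶠ T in 𝓝 (1 : E →L[ℝ] E), IsUnit T := Units.isOpen.mem_nhds isUnit_one
  -- Analyticity at β holds on a whole neighbourhood, whereas for C^∞ at a point the neighbourhoods
  -- could shrink with the order; hence ω in place of ∞ up to here.
  have hall := (hAd.eventually (by simp)).and ((hCt.eventually hRsq).and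
    ((hAt.eventually hRu).and (hBt.eventually hunit)))
  obtain ⟨N, hN, hNo, hβN⟩ := eventually_nhds_iff.1 hall
  refine ⟨N, A, hNo, hβN, fun G hG => ((hN G hG).1.of_le le_top).contDiffWithinAt, hAβ, ?_⟩
  intro G hG hGs v w
  obtain ⟨-, h1, h2, h3⟩ := hN G hG
  have hBC : B G * C G = 1 := Ring.mul_inverse_cancel _ h3
  have hCB : C G * B G = 1 := Ring.inverse_mul_cancel _ h3
  have hBadj : adj (B G) = B G := by
    ext v
    refine hext _ _ fun w => ?_
    rw [hadj, hB, hβ, hB, hGs]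
  have hCadj : adj (C G) = C G := by
    have h4 : adj (C G) * B G = 1 := by rw [← hBadj, ← hadjm, hBC, hadj1]
    calc adj (C G) = adj (C G) * (B G * C G) := by rw [hBC, mul_one]
      _ = C G := by rw [← mul_assoc, h4, one_mul]
  have hAA : A G * A G = C G := h1
  -- The adjoint of A squares to the adjoint of C, which is C, and it is close to 1; by uniqueness
  -- of the square root near 1 it equals A.
  have hAadj : adj (A G) = A G := by
    rw [← hadjm, hAA, hCadj] at h2
    exact h2.symm
  have hAC : A G * C G = C G * A G := by rw [← hAA, mul_assoc]
  have hAB : A G * B G = B G * A G :=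
    calc A G * B G = B G * C G * (A G * B G) := by rw [hBC, one_mul]
      _ = B G * (C G * A G) * B G := by simp only [mul_assoc]
      _ = B G * A G * (C G * B G) := by rw [← hAC]; simp only [mul_assoc]
      _ = B G * A G := by rw [hCB, mul_one]
  have hABA : A G * (B G * A G) = 1 := by
    rw [← mul_assoc, hAB, mul_assoc, hAA, hBC]
  rw [← hB, ← hadj, hAadj]
  exact congrArg (fun T : E →L[ℝ] E => β (T v) w) hABA

end SquareRoot

/-! ### Dimension of the spin space -/

section SpinSpaces

variable {S : Type*} [NormedAddCommGroup S] [NormedSpace ℂ S]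

theorem SpinSpace.finiteDimensional (σ : SpinSpace S) : FiniteDimensional ℂ S :=
  Module.finite_of_finrank_pos (by rw [σ.finrank_eq]; positivity)

theorem SpinSpace.nontrivial (σ : SpinSpace S) : Nontrivial S :=
  Module.nontrivial_of_finrank_pos (R := ℂ) (by rw [σ.finrank_eq]; positivity)

end SpinSpaces

section Geometry

variable {E : Type*} [NormedAddCommGroup E] [NormedSpace ℝ E]
  {M : Type*} [TopologicalSpace M] [ChartedSpace E M] [IsManifold 𝓘(ℝ, E) ∞ M]
  {F : Type*} [NormedAddCommGroup F] [NormedSpace ℂ F]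
  {Sig : M → Type*} [∀ x, AddCommGroup (Sig x)] [∀ x, Module ℂ (Sig x)]
  [∀ x, TopologicalSpace (Sig x)] [TopologicalSpace (TotalSpace F Sig)] [FiberBundle F Sig]
  {g : MetricField E M} {τ : CliffordModuleBundle F Sig g}
  {S : Type*} [NormedAddCommGroup S] [NormedSpace ℂ S] {σ : SpinSpace S}

/-! ### Clifford multiplication by tangent vectors -/

theorem MetricField.quad_apply (x : M) (X : TangentSpace 𝓘(ℝ, E) x) :
    g.quad x X = g.inner x X X := rfl

theorem MetricField.polar_quad (x : M) (X Y : TangentSpace 𝓘(ℝ, E) x) :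
    QuadraticMap.polar (g.quad x) X Y = 2 * g.inner x X Y := by
  simp only [QuadraticMap.polar, MetricField.quad_apply, map_add, add_apply, g.symm x Y X]
  ring

namespace CliffordModuleBundle

theorem clifford_add (x : M) (X Y : TangentSpace 𝓘(ℝ, E) x) :
    τ.clifford x (X + Y) = τ.clifford x X + τ.clifford x Y := by
  simp [clifford]

theorem clifford_smul (x : M) (c : ℝ) (X : TangentSpace 𝓘(ℝ, E) x) :
    τ.clifford x (c • X) = c • τ.clifford x X := by
  simp [clifford]

theorem clifford_mul_self (x : M) (X : TangentSpace 𝓘(ℝ, E) x) :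
    τ.clifford x X * τ.clifford x X = algebraMap ℝ _ (g.quad x X) := by
  rw [clifford, ← map_mul, CliffordAlgebra.ι_sq_scalar, AlgHom.commutes]

/-- Clifford multiplication by tangent vectors is injective, since the metric is nondegenerate;
so faithfulness of `τ` is not needed for this. -/
theorem clifford_injective (x : M) [Nontrivial (Sig x)] :
    Function.Injective (τ.clifford x) := by
  intro X Y h
  rw [← sub_eq_zero]
  refine g.nondegenerate x _ fun Z => ?_
  have h0 : τ.rep x (CliffordAlgebra.ι (g.quad x) (X - Y)) = 0 := by
    rw [map_sub, map_sub]; exact sub_eq_zero.2 h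
  have h1 := congrArg (τ.rep x) (CliffordAlgebra.ι_mul_ι_add_swap (Q := g.quad x) (X - Y) Z)
  rw [map_add, map_mul, map_mul, h0, zero_mul, mul_zero, add_zero, AlgHom.commutes,
    MetricField.polar_quad] at h1
  have h2 := (algebraMap ℝ (Module.End ℂ (Sig x))).injective (h1.symm.trans (map_zero _).symm)
  linarith

end CliffordModuleBundle

/-! ### Isomorphisms of spin spaces -/

namespace SpinIso

theorem nontrivial {x : M} (q : SpinIso σ τ x) : Nontrivial (Sig x) :=
  have := σ.nontrivial
  q.1.symm.toEquiv.nontrivial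

theorem exists_clifford_eq {x : M} (q : SpinIso σ τ x) (v : σ.V) :
    ∃ X, τ.clifford x X = q.1.conj ((v : S →L[ℂ] S) : S →ₗ[ℂ] S) := by
  have h : q.1.conj ((v : S →L[ℂ] S) : S →ₗ[ℂ] S) ∈ Set.range (τ.clifford x) :=
    q.2.subset ⟨v, rfl⟩
  exact h

theorem exists_conj_eq {x : M} (q : SpinIso σ τ x) (X : TangentSpace 𝓘(ℝ, E) x) :
    ∃ v : σ.V, q.1.conj ((v : S →L[ℂ] S) : S →ₗ[ℂ] S) = τ.clifford x X := by
  have h : τ.clifford x X ∈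
      Set.range (fun v : σ.V => q.1.conj ((v : S →L[ℂ] S) : S →ₗ[ℂ] S)) := by
    rw [q.2]; exact ⟨X, rfl⟩
  exact h

/-- The vector `χ(q) v`, determined by `τ(χ(q) v) = q v q⁻¹`. -/
def vector {x : M} (q : SpinIso σ τ x) (v : σ.V) : TangentSpace 𝓘(ℝ, E) x :=
  (q.exists_clifford_eq v).choose

theorem clifford_vector {x : M} (q : SpinIso σ τ x) (v : σ.V) :
    τ.clifford x (q.vector v) = q.1.conj ((v : S →L[ℂ] S) : S →ₗ[ℂ] S) :=
  (q.exists_clifford_eq v).choose_spec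

theorem clifford_vector_apply {x : M} (q : SpinIso σ τ x) (v : σ.V) (s : S) :
    τ.clifford x (q.vector v) (q.1 s) = q.1 ((v : S →L[ℂ] S) s) := by
  rw [clifford_vector]
  simp [LinearEquiv.conj_apply]

/-- The vector χ(q) v is obtained by choice, but injectivity of Clifford multiplication makes it
unique. Linearity and equivariance of χ(q) are verified through this criterion. -/
theorem vector_eq {x : M} (q : SpinIso σ τ x) {v : σ.V} {X : TangentSpace 𝓘(ℝ, E) x}
    (h : ∀ s, τ.clifford x X (q.1 s) = q.1 ((v : S →L[ℂ] S) s)) : q.vector v = X := by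
  have := q.nontrivial
  apply CliffordModuleBundle.clifford_injective (τ := τ) x
  ext w
  obtain ⟨s, rfl⟩ := q.1.surjective w
  rw [h, clifford_vector_apply]

/-- The isometry `χ(q) : (V, h) → (T_x M, g_x)`, determined by `τ(χ(q) v) = q v q⁻¹`. -/
def frame {x : M} (q : SpinIso σ τ x) : OrthonormalFrame σ g x where
  __ := LinearEquiv.ofBijective
    ({ toFun := q.vector
       map_add' := fun v w => q.vector_eq fun s => by
         rw [CliffordModuleBundle.clifford_add]
         simp [clifford_vector_apply]
       map_smul' := fun c v => q.vector_eq fun s => by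
         rw [RingHom.id_apply, CliffordModuleBundle.clifford_smul, LinearMap.smul_apply,
           clifford_vector_apply]
         exact (q.1.toLinearMap.map_smul_of_tower c _).symm } : σ.V →ₗ[ℝ] TangentSpace 𝓘(ℝ, E) x)
    (by
      constructor
      · intro v w h
        ext s
        apply q.1.injective
        have h' : q.vector v = q.vector w := h
        rw [← clifford_vector_apply, ← clifford_vector_apply, h']
      · intro X
        obtain ⟨v, hv⟩ := q.exists_conj_eq X
        refine ⟨v, q.vector_eq fun s => ?_⟩
        rw [← hv]
        simp [LinearEquiv.conj_apply])
  -- Scalars are compared in End Σ_x: τ(χ(q) v)² = q v² q⁻¹.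
  map_app' v := by
    have := q.nontrivial
    apply (algebraMap ℝ (Module.End ℂ (Sig x))).injective
    change algebraMap ℝ _ (g.quad x (q.vector v)) = _
    rw [← CliffordModuleBundle.clifford_mul_self (τ := τ)]
    ext w
    obtain ⟨s, rfl⟩ := q.1.surjective w
    rw [Module.End.mul_apply, clifford_vector_apply, clifford_vector_apply]
    have h := DFunLike.congr_fun (σ.sq_eq v) s
    rw [mul_apply_eq_comp] at h
    rw [h, Module.algebraMap_end_apply]
    exact q.1.toLinearMap.map_smul_of_tower _ s

theorem frame_apply {x : M} (q : SpinIso σ τ x) (v : σ.V) : q.frame v = q.vector v := rfl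

theorem op_smul_apply {x : M} (q : SpinIso σ τ x) (a : σ.Lpin) (s : S) :
    (MulOpposite.op a • q).1 s = q.1 (((a : (S →L[ℂ] S)ˣ) : S →L[ℂ] S) s) := rfl

@[ext]
theorem ext {x : M} {q p : SpinIso σ τ x} (h : ∀ s, q.1 s = p.1 s) : q = p :=
  Subtype.ext (LinearEquiv.ext h)

/-- The element `q⁻¹ p` of the Lipschitz group. -/
def ratio {x : M} (q p : SpinIso σ τ x) : σ.Lpin :=
  have := σ.finiteDimensional
  ⟨(ContinuousLinearEquiv.unitsEquiv ℂ S).symm (p.1.trans q.1.symm).toContinuousLinearEquiv, by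
    -- The operator p v p⁻¹ is Clifford multiplication by a tangent vector, hence of the form q w
    -- q⁻¹ with w in V. This is one inclusion for q⁻¹p; exchanging q and p gives the other.
    have key : ∀ q p : SpinIso σ τ x, ∀ v ∈ σ.V, ∃ w ∈ σ.V, ∀ s,
        q.1.symm (p.1 (v (p.1.symm (q.1 s)))) = w s := fun q p v hv => by
      obtain ⟨w, hw⟩ := q.exists_conj_eq (p.vector ⟨v, hv⟩)
      refine ⟨w, w.2, fun s => ?_⟩
      rw [clifford_vector] at hw
      have h := DFunLike.congr_fun hw (q.1 s)
      simp only [LinearEquiv.conj_apply, LinearMap.comp_apply, LinearEquiv.coe_coe,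
        LinearEquiv.symm_apply_apply, ContinuousLinearMap.coe_coe] at h
      rw [← h, LinearEquiv.symm_apply_apply]
    intro v
    constructor
    · intro hv
      obtain ⟨w, hw, h⟩ := key q p v hv
      convert hw
      ext s
      exact h s
    · intro hv
      obtain ⟨w, hw, h⟩ := key p q _ hv
      convert hw
      ext s
      rw [← h s]
      change v s = p.1.symm (q.1 (q.1.symm (p.1 (v (p.1.symm (q.1 (q.1.symm (p.1 s))))))))
      simp⟩

theorem ratio_apply {x : M} (q p : SpinIso σ τ x) (s : S) :
    ((ratio q p : (S →L[ℂ] S)ˣ) : S →L[ℂ] S) s = q.1.symm (p.1 s) := rfl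

theorem lpin_ext {a b : σ.Lpin}
    (h : ∀ s, ((a : (S →L[ℂ] S)ˣ) : S →L[ℂ] S) s = ((b : (S →L[ℂ] S)ˣ) : S →L[ℂ] S) s) :
    a = b :=
  Subtype.ext (Units.ext (ContinuousLinearMap.ext h))

/-- Transitivity of the action on a fibre. Together with `ratio_op_smul` and `ratio_self`, it makes
p ↦ q⁻¹p an equivariant bijection of the fibre with Lpin(h). -/
theorem op_ratio_smul {x : M} (q p : SpinIso σ τ x) : MulOpposite.op (ratio q p) • q = p := by
  ext s
  rw [op_smul_apply, ratio_apply, LinearEquiv.apply_symm_apply]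

theorem ratio_op_smul {x : M} (q p : SpinIso σ τ x) (a : σ.Lpin) :
    ratio q (MulOpposite.op a • p) = ratio q p * a :=
  lpin_ext fun _ => rfl

theorem ratio_self {x : M} (q : SpinIso σ τ x) : ratio q q = 1 :=
  lpin_ext fun s => q.1.symm_apply_apply s

theorem frame_op_smul {x : M} (q : SpinIso σ τ x) (a : σ.Lpin) (v : σ.V) :
    (MulOpposite.op a • q).frame v = q.frame (σ.Ad a v) := by
  refine vector_eq _ fun s => ?_
  rw [op_smul_apply, op_smul_apply, frame_apply, clifford_vector_apply]
  congr 1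
  change ((((a : (S →L[ℂ] S)ˣ) : S →L[ℂ] S) * v *
    (((a : (S →L[ℂ] S)ˣ)⁻¹ : (S →L[ℂ] S)ˣ) : S →L[ℂ] S)) *
      ((a : (S →L[ℂ] S)ˣ) : S →L[ℂ] S)) s = _
  rw [Units.inv_mul_cancel_right]
  rfl

end SpinIso

end Geometry

section Geometry

variable {E : Type*} [NormedAddCommGroup E] [NormedSpace ℝ E]
  {M : Type*} [TopologicalSpace M] [ChartedSpace E M] [IsManifold 𝓘(ℝ, E) ∞ M]
  {F : Type*} [NormedAddCommGroup F] [NormedSpace ℂ F]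
  {Sig : M → Type*} [∀ x, AddCommGroup (Sig x)] [∀ x, Module ℂ (Sig x)]
  [∀ x, TopologicalSpace (Sig x)] [TopologicalSpace (TotalSpace F Sig)] [FiberBundle F Sig]
  {g : MetricField E M}
  {S : Type*} [NormedAddCommGroup S] [NormedSpace ℂ S]

/-! ### Smooth local families of spin space isomorphisms -/

/-- A smooth family of isomorphisms of a spin space onto the fibres of a spinor bundle over an
open set (outside of which the values are irrelevant). -/
structure SmoothSpinFrame (σ : SpinSpace S) (τ : CliffordModuleBundle F Sig g) where
  baseSet : Set M
  isOpen : IsOpen baseSet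
  spin : ∀ x, SpinIso σ τ x
  smooth_spin : ∀ s : S, SmoothSection E F (fun x => (spin x).1 s) baseSet
  -- This is the smoothness of χ along the family. It costs nothing, because the families are
  -- constructed as lifts of smooth orthonormal frames.
  smooth_frame : ∀ v : σ.V, SmoothField (fun x => (spin x).frame v) baseSet

/-- Smooth local families of spin space isomorphisms exist near every point. -/
class HasSmoothSpinFrames (σ : SpinSpace S) (τ : CliffordModuleBundle F Sig g) : Prop where
  exists_mem_baseSet : ∀ x, ∃ f : SmoothSpinFrame σ τ, x ∈ f.baseSet

variable {σ : SpinSpace S} {τ : CliffordModuleBundle F Sig g}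

section Coordinates

variable [VectorBundle ℂ F Sig]

/-- The coordinate expression of `q : S → Sig x` in a local trivialization of `Sig`. -/
def SpinIso.coord (t : Trivialization F (π F Sig)) [MemTrivializationAtlas t] {x : M}
    (q : SpinIso σ τ x) : S →L[ℂ] F :=
  have := σ.finiteDimensional
  LinearMap.toContinuousLinearMap (t.linearMapAt ℂ x ∘ₗ q.1.toLinearMap)

variable (t : Trivialization F (π F Sig)) [MemTrivializationAtlas t]

theorem SpinIso.coord_apply {x : M} (hx : x ∈ t.baseSet) (q : SpinIso σ τ x) (s : S) :
    q.coord t s = (t ⟨x, q.1 s⟩).2 := by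
  change t.linearMapAt ℂ x (q.1 s) = _
  rw [t.coe_linearMapAt_of_mem hx]

theorem SpinIso.isInvertible_coord {x : M} (hx : x ∈ t.baseSet) (q : SpinIso σ τ x) :
    (q.coord t).IsInvertible := by
  have := σ.finiteDimensional
  have := (q.1.trans (t.linearEquivAt ℂ x hx)).finiteDimensional
  refine ⟨(q.1.trans (t.linearEquivAt ℂ x hx)).toContinuousLinearEquiv, ?_⟩
  ext s
  rw [q.coord_apply t hx]
  rfl

theorem SpinIso.inverse_coord_apply {x : M} (hx : x ∈ t.baseSet) (q : SpinIso σ τ x)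
    (z : Sig x) : (q.coord t).inverse (t ⟨x, z⟩).2 = q.1.symm z := by
  obtain ⟨s, rfl⟩ := q.1.surjective z
  rw [← q.coord_apply t hx, LinearEquiv.symm_apply_apply]
  exact DFunLike.congr_fun (q.isInvertible_coord t hx).inverse_comp_self s

variable [ContMDiffVectorBundle ∞ F Sig 𝓘(ℝ, E)]

theorem SmoothSpinFrame.contMDiffOn_coord (f : SmoothSpinFrame σ τ) :
    ContMDiffOn 𝓘(ℝ, E) 𝓘(ℝ, S →L[ℂ] F) ∞ (fun x => (f.spin x).coord t)
      (f.baseSet ∩ t.baseSet) := by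
  have := σ.finiteDimensional
  refine contMDiffOn_clm_of_apply fun s => ?_
  have h := (t.contMDiffOn_section_iff (IB := 𝓘(ℝ, E)) (n := ∞) (s := fun x => (f.spin x).1 s)
    (f.isOpen.inter t.open_baseSet) Set.inter_subset_right).1
    ((f.smooth_spin s).mono Set.inter_subset_left)
  exact h.congr fun x hx => (f.spin x).coord_apply t hx.2 s

theorem SmoothSpinFrame.contMDiffOn_inverse_coord (f : SmoothSpinFrame σ τ) :
    ContMDiffOn 𝓘(ℝ, E) 𝓘(ℝ, F →L[ℂ] S) ∞ (fun x => ((f.spin x).coord t).inverse)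
      (f.baseSet ∩ t.baseSet) :=
  have := σ.finiteDimensional
  have : CompleteSpace S := FiniteDimensional.complete ℂ S
  contMDiffOn_clm_inverse (f.contMDiffOn_coord t) fun x hx => (f.spin x).isInvertible_coord t hx.2

/-- In a trivialization t of Σ, q⁻¹p = (t q)⁻¹ (t p), and inversion of linear maps is smooth. -/
theorem SmoothSpinFrame.contMDiffOn_ratio (f f' : SmoothSpinFrame σ τ) :
    ContMDiffOn 𝓘(ℝ, E) 𝓘(ℝ, S →L[ℂ] S) ∞
      (fun x => ((SpinIso.ratio (f.spin x) (f'.spin x) : (S →L[ℂ] S)ˣ) : S →L[ℂ] S))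
      (f.baseSet ∩ f'.baseSet) := by
  intro x hx
  let t := trivializationAt F Sig x
  have hxt : x ∈ t.baseSet := FiberBundle.mem_baseSet_trivializationAt F Sig x
  have h1 := contMDiffOn_clm_comp
    ((f.contMDiffOn_inverse_coord t).mono (t := f.baseSet ∩ f'.baseSet ∩ t.baseSet)
      fun y hy => ⟨hy.1.1, hy.2⟩)
    ((f'.contMDiffOn_coord t).mono (t := f.baseSet ∩ f'.baseSet ∩ t.baseSet)
      fun y hy => ⟨hy.1.2, hy.2⟩)
  have h2 := h1.congr (f₁ := fun x =>
      ((SpinIso.ratio (f.spin x) (f'.spin x) : (S →L[ℂ] S)ˣ) : S →L[ℂ] S)) fun y hy => by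
    ext s
    rw [ContinuousLinearMap.comp_apply, SpinIso.coord_apply t hy.2,
      SpinIso.inverse_coord_apply t hy.2, SpinIso.ratio_apply]
  exact (h2.contMDiffAt (((f.isOpen.inter f'.isOpen).inter t.open_baseSet).mem_nhds
    ⟨hx, hxt⟩)).contMDiffWithinAt

/-- The units are open in the Banach algebra End S and carry the induced topology, so continuity
into Lpin(h) can be tested in End S. -/
theorem SmoothSpinFrame.continuousOn_ratio (f f' : SmoothSpinFrame σ τ) :
    ContinuousOn (fun x => SpinIso.ratio (f.spin x) (f'.spin x)) (f.baseSet ∩ f'.baseSet) := by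
  have := σ.finiteDimensional
  have : CompleteSpace S := FiniteDimensional.complete ℂ S
  rw [Topology.IsInducing.subtypeVal.continuousOn_iff,
    (Units.isOpenEmbedding_val (R := S →L[ℂ] S)).isInducing.continuousOn_iff]
  exact (f.contMDiffOn_ratio f').continuousOn

end Coordinates

/-! ### The principal bundle of spin space isomorphisms -/

/-- The local trivialization of the bundle of spin space isomorphisms defined by a smooth
family. -/
def SmoothSpinFrame.pretriv (f : SmoothSpinFrame σ τ) :
    Pretrivialization σ.Lpin (π σ.Lpin (SpinIso σ τ)) where
  toFun p := (p.1, SpinIso.ratio (f.spin p.1) p.2)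
  invFun p := ⟨p.1, MulOpposite.op p.2 • f.spin p.1⟩
  source := π σ.Lpin (SpinIso σ τ) ⁻¹' f.baseSet
  target := f.baseSet ×ˢ Set.univ
  map_source' p hp := ⟨hp, trivial⟩
  map_target' p hp := hp.1
  left_inv' p _ := by
    obtain ⟨x, q⟩ := p
    simp only [SpinIso.op_ratio_smul]
  right_inv' p _ := by
    simp only [SpinIso.ratio_op_smul, SpinIso.ratio_self, one_mul]
  open_target := f.isOpen.prod isOpen_univ
  baseSet := f.baseSet
  open_baseSet := f.isOpen
  source_eq := rfl
  target_eq := rfl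
  proj_toFun _ _ := rfl

variable (σ τ) in
/-- A smooth family of spin space isomorphisms near a given point. -/
def smoothSpinFrameAt [HasSmoothSpinFrames σ τ] (x : M) : SmoothSpinFrame σ τ :=
  (HasSmoothSpinFrames.exists_mem_baseSet (σ := σ) (τ := τ) x).choose

theorem mem_baseSet_smoothSpinFrameAt [HasSmoothSpinFrames σ τ] (x : M) :
    x ∈ (smoothSpinFrameAt σ τ x).baseSet :=
  (HasSmoothSpinFrames.exists_mem_baseSet (σ := σ) (τ := τ) x).choose_spec

/-- By transitivity the first component can be prescribed: [(q', s)] = [(q, q⁻¹q' s)]. -/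
theorem exists_eq_assocMk {x : M} (q : SpinIso σ τ x)
    (z : AssocBundle σ.Lpin (SpinIso σ τ) x) : ∃ s, z = AssocBundle.mk q s := by
  obtain ⟨⟨q', s⟩, rfl⟩ := Quotient.exists_rep z
  exact ⟨((SpinIso.ratio q q' : (S →L[ℂ] S)ˣ) : S →L[ℂ] S) s,
    (Quotient.sound (s := assocSetoid σ.Lpin (SpinIso σ τ) x)
      (show (assocSetoid σ.Lpin (SpinIso σ τ) x).r _ _ from
        ⟨SpinIso.ratio q q', (SpinIso.op_ratio_smul q q').symm, rfl⟩)).symm⟩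

section Bundle

variable [HasSmoothSpinFrames σ τ]

instance (x : M) : TopologicalSpace (SpinIso σ τ x) :=
  TopologicalSpace.induced (SpinIso.ratio ((smoothSpinFrameAt σ τ x).spin x)) inferInstance

variable [VectorBundle ℂ F Sig] [ContMDiffVectorBundle ∞ F Sig 𝓘(ℝ, E)]

variable (σ τ) in
/-- The fibre bundle structure of the set of spin space isomorphisms. -/
def spinPrebundle : FiberPrebundle σ.Lpin (SpinIso σ τ) where
  pretrivializationAtlas := {e | ∃ f : SmoothSpinFrame σ τ, e = f.pretriv}
  pretrivializationAt x := (smoothSpinFrameAt σ τ x).pretriv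
  mem_base_pretrivializationAt x := mem_baseSet_smoothSpinFrameAt x
  pretrivialization_mem_atlas x := ⟨_, rfl⟩
  continuous_trivChange := by
    rintro _ ⟨f, rfl⟩ _ ⟨f', rfl⟩
    -- A change of trivialization is left multiplication by the ratio of the two families, which is
    -- why it commutes with the right action.
    have h1 : ContinuousOn
        (fun p : M × σ.Lpin => (p.1, SpinIso.ratio (f.spin p.1) (f'.spin p.1) * p.2))
        ((f.baseSet ∩ f'.baseSet) ×ˢ Set.univ) :=
      continuousOn_fst.prodMk
        (((f.continuousOn_ratio f').comp continuousOn_fst fun p hp => hp.1).mul continuousOn_snd)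
    refine (h1.congr fun p _ => ?_).mono ?_
    · exact Prod.ext rfl (SpinIso.ratio_op_smul _ _ _)
    · exact fun p hp => ⟨⟨hp.2, hp.1.1⟩, trivial⟩
  totalSpaceMk_isInducing x := by
    change Topology.IsInducing
      (fun q : SpinIso σ τ x => (x, SpinIso.ratio ((smoothSpinFrameAt σ τ x).spin x) q))
    exact Topology.isInducing_const_prod.2 ⟨rfl⟩

instance : TopologicalSpace (TotalSpace σ.Lpin (SpinIso σ τ)) :=
  (spinPrebundle σ τ).totalSpaceTopology

instance : FiberBundle σ.Lpin (SpinIso σ τ) := (spinPrebundle σ τ).toFiberBundle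

/-- The bundle atlas consists exactly of the trivializations given by smooth families, so conditions
on all of its members become statements about `SpinIso.ratio`. -/
theorem exists_smoothSpinFrame (e : Trivialization σ.Lpin (π σ.Lpin (SpinIso σ τ)))
    [he : MemTrivializationAtlas e] :
    ∃ f : SmoothSpinFrame σ τ, e.baseSet = f.baseSet ∧
      (∀ x (q : SpinIso σ τ x), e ⟨x, q⟩ = (x, SpinIso.ratio (f.spin x) q)) ∧
      ∀ x a, e.toOpenPartialHomeomorph.symm (x, a) = ⟨x, MulOpposite.op a • f.spin x⟩ := by
  obtain ⟨_, ⟨f, rfl⟩, rfl⟩ := he.out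
  exact ⟨f, rfl, fun x q => rfl, fun x a => rfl⟩

instance : IsPrincipalBundle σ.Lpin (SpinIso σ τ) where
  map_smul e _ x _ q a := by
    obtain ⟨f, -, h, -⟩ := exists_smoothSpinFrame e
    rw [h, h, SpinIso.ratio_op_smul]

instance : IsSmoothPrincipalBundle σ.Lpin (SpinIso σ τ) (E := E) where
  contMDiffOn_transition e e' _ _ := by
    obtain ⟨f, hf, -, h⟩ := exists_smoothSpinFrame e
    obtain ⟨f', hf', h', -⟩ := exists_smoothSpinFrame e'
    rw [hf, hf', Set.inter_comm]
    refine (f'.contMDiffOn_ratio f).congr fun x _ => ?_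
    rw [h, h', SpinIso.ratio_op_smul, mul_one]

variable (σ τ) in
/-- The lpin structure defined by a spinor bundle. -/
def lpinStructure : LpinStructure σ g (SpinIso σ τ) where
  smooth := inferInstance
  χ _ q := q.frame
  χ_smul _ q a v := q.frame_op_smul a v
  χ_smooth e _ q hq v := by
    obtain ⟨f, hf, h, -⟩ := exists_smoothSpinFrame e
    -- The local section with coordinate 1 is the family that defines the trivialization.
    have hqf : ∀ x ∈ e.baseSet, q x = f.spin x := fun x hx => by
      have h1 := hq x hx
      rw [h] at h1
      rw [← SpinIso.op_ratio_smul (f.spin x) (q x), show SpinIso.ratio (f.spin x) (q x) = 1 from congrArg Prod.snd h1]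
      exact one_smul _ _
    rw [hf] at hqf ⊢
    exact (f.smooth_frame v).congr fun x hx => by simp only [hqf x hx]

/-! ### The associated bundle -/

/-- The linear isomorphism `[(q, s)] ↦ q(s)` of the fibres. -/
def assocEquiv (x : M) : AssocBundle σ.Lpin (SpinIso σ τ) x ≃ₗ[ℂ] Sig x :=
  let φ : AssocBundle σ.Lpin (SpinIso σ τ) x → Sig x :=
    Quotient.lift (s := assocSetoid σ.Lpin (SpinIso σ τ) x) (fun p => p.1.1 p.2) (by
      rintro ⟨q, s⟩ ⟨q', s'⟩ ⟨a, h1, h2⟩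
      dsimp only at h1 h2
      rw [h1, h2]
      rfl)
  have hφ : ∀ (q : SpinIso σ τ x) (s : S), φ (AssocBundle.mk q s) = q.1 s := fun _ _ => rfl
  let q₀ : SpinIso σ τ x := (smoothSpinFrameAt σ τ x).spin x
  LinearEquiv.ofBijective
    ({ toFun := φ
       map_add' := fun z z' => by
         obtain ⟨s, rfl⟩ := exists_eq_assocMk q₀ z
         obtain ⟨s', rfl⟩ := exists_eq_assocMk q₀ z'
         rw [← AssocBundle.mk_add, hφ, hφ, hφ, map_add]
       map_smul' := fun c z => by
         obtain ⟨s, rfl⟩ := exists_eq_assocMk q₀ z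
         rw [← AssocBundle.mk_smul, hφ, hφ, map_smul, RingHom.id_apply] } :
      AssocBundle σ.Lpin (SpinIso σ τ) x →ₗ[ℂ] Sig x)
    (by
      constructor
      · intro z z' h
        obtain ⟨s, rfl⟩ := exists_eq_assocMk q₀ z
        obtain ⟨s', rfl⟩ := exists_eq_assocMk q₀ z'
        have h' : q₀.1 s = q₀.1 s' := h
        rw [q₀.1.injective h']
      · intro w
        exact ⟨AssocBundle.mk q₀ (q₀.1.symm w), q₀.1.apply_symm_apply w⟩)

theorem assocEquiv_mk {x : M} (q : SpinIso σ τ x) (s : S) :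
    assocEquiv x (AssocBundle.mk q s : AssocBundle σ.Lpin (SpinIso σ τ) x) = q.1 s := rfl

/-- Local coordinates of the associated bundle in which the isomorphism with the spinor bundle
is given by a smooth family of spin space isomorphisms. -/
theorem exists_assocTrivialization (x : M) :
    ∃ (f : SmoothSpinFrame σ τ)
      (e : Trivialization S (π S (AssocBundle σ.Lpin (SpinIso σ τ))))
      (_ : MemTrivializationAtlas e), x ∈ f.baseSet ∧ e.baseSet = f.baseSet ∧
      ∀ y ∈ f.baseSet, ∀ z, (e ⟨y, z⟩).2 = (f.spin y).1.symm (assocEquiv y z) := by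
  let e₀ := trivializationAt σ.Lpin (SpinIso σ τ) x
  obtain ⟨f, hf, h, -⟩ := exists_smoothSpinFrame e₀
  have hx : x ∈ e₀.baseSet := FiberBundle.mem_baseSet_trivializationAt _ _ x
  refine ⟨f, trivializationAt S (AssocBundle σ.Lpin (SpinIso σ τ)) x, inferInstance,
    hf ▸ hx, hf, fun y hy z => ?_⟩
  obtain ⟨s, rfl⟩ := exists_eq_assocMk (f.spin y) z
  have h1 := AssocBundle.pretriv_mk e₀ (x := y) (hf ▸ hy) (f.spin y) s
  rw [assocEquiv_mk, LinearEquiv.symm_apply_apply]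
  refine h1.trans ?_
  rw [h]
  exact (f.spin y).1.symm_apply_apply s

variable (σ τ) in
/-- The isomorphism `[(q, s)] ↦ q(s)` of the bundle associated with the lpin structure of a spinor
bundle onto the spinor bundle. -/
def assocIso : SmoothBundleIso (E := E) S (AssocBundle σ.Lpin (SpinIso σ τ)) F Sig where
  equiv := assocEquiv
  contMDiff_equiv := by
    have := AssocBundle.contMDiffVectorBundle (E := E) (S := S) σ.Lpin (SpinIso σ τ)
    intro p
    let t := trivializationAt F Sig p.1
    have hxt : p.1 ∈ t.baseSet := FiberBundle.mem_baseSet_trivializationAt F Sig p.1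
    obtain ⟨f, e, _, hxf, hef, he⟩ := exists_assocTrivialization (σ := σ) (τ := τ) p.1
    let U : Set (TotalSpace S (AssocBundle σ.Lpin (SpinIso σ τ))) :=
      π S (AssocBundle σ.Lpin (SpinIso σ τ)) ⁻¹' (f.baseSet ∩ t.baseSet)
    have hU : IsOpen U := (f.isOpen.inter t.open_baseSet).preimage (FiberBundle.continuous_proj _ _)
    have h1 : ContMDiffOn (𝓘(ℝ, E).prod 𝓘(ℝ, S)) 𝓘(ℝ, E) ∞
        (π S (AssocBundle σ.Lpin (SpinIso σ τ))) U := (contMDiff_proj _).contMDiffOn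
    have h2 : ContMDiffOn (𝓘(ℝ, E).prod 𝓘(ℝ, S)) 𝓘(ℝ, S) ∞ (fun q => (e q).2) U :=
      (contMDiff_snd.comp_contMDiffOn e.contMDiffOn).mono fun q hq => e.mem_source.2 (hef ▸ hq.1)
    -- In the coordinates e and t the isomorphism is s ↦ (t q_x) s, where q_x is the smooth family;
    -- its inverse, below, is w ↦ (t q_x)⁻¹ w.
    have h3 := contMDiffOn_clm_apply_complex
      ((f.contMDiffOn_coord t).comp h1 fun q hq => hq) h2
    refine (ContMDiffOn.contMDiffAt (s := U) ?_ (hU.mem_nhds ⟨hxf, hxt⟩))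
    rw [t.contMDiffOn_iff fun q hq => t.mem_source.2 hq.2]
    refine ⟨h1, h3.congr fun q hq => ?_⟩
    rw [Function.comp_apply, SpinIso.coord_apply t hq.2]
    rw [he _ hq.1, LinearEquiv.apply_symm_apply]
  contMDiff_symm := by
    have := AssocBundle.contMDiffVectorBundle (E := E) (S := S) σ.Lpin (SpinIso σ τ)
    intro p
    let t := trivializationAt F Sig p.1
    have hxt : p.1 ∈ t.baseSet := FiberBundle.mem_baseSet_trivializationAt F Sig p.1
    obtain ⟨f, e, _, hxf, hef, he⟩ := exists_assocTrivialization (σ := σ) (τ := τ) p.1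
    let U : Set (TotalSpace F Sig) := π F Sig ⁻¹' (f.baseSet ∩ t.baseSet)
    have hU : IsOpen U := (f.isOpen.inter t.open_baseSet).preimage (FiberBundle.continuous_proj _ _)
    have h1 : ContMDiffOn (𝓘(ℝ, E).prod 𝓘(ℝ, F)) 𝓘(ℝ, E) ∞ (π F Sig) U :=
      (contMDiff_proj _).contMDiffOn
    have h2 : ContMDiffOn (𝓘(ℝ, E).prod 𝓘(ℝ, F)) 𝓘(ℝ, F) ∞ (fun q => (t q).2) U :=
      (contMDiff_snd.comp_contMDiffOn t.contMDiffOn).mono fun q hq => t.mem_source.2 hq.2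
    have h3 := contMDiffOn_clm_apply_complex
      ((f.contMDiffOn_inverse_coord t).comp h1 fun q hq => hq) h2
    refine (ContMDiffOn.contMDiffAt (s := U) ?_ (hU.mem_nhds ⟨hxf, hxt⟩))
    rw [e.contMDiffOn_iff fun q hq => e.mem_source.2 (hef ▸ hq.1)]
    refine ⟨h1, h3.congr fun q hq => ?_⟩
    rw [he _ hq.1, LinearEquiv.apply_symm_apply]
    exact (SpinIso.inverse_coord_apply t hq.2 _ _).symm

/-- For X = χ(q) v and z = [(q, s)], both sides are q(v s). -/
theorem assocEquiv_clifford {x : M} (X : TangentSpace 𝓘(ℝ, E) x)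
    (z : AssocBundle σ.Lpin (SpinIso σ τ) x) :
    assocEquiv x ((lpinStructure σ τ).clifford x X z) = τ.clifford x X (assocEquiv x z) := by
  obtain ⟨s, rfl⟩ := exists_eq_assocMk ((smoothSpinFrameAt σ τ x).spin x) z
  set q := (smoothSpinFrameAt σ τ x).spin x
  obtain ⟨v, rfl⟩ := q.frame.toLinearEquiv.surjective X
  rw [assocEquiv_mk]
  refine Eq.trans ?_ (q.clifford_vector_apply v s).symm
  change q.1 (((q.frame.toLinearEquiv.symm (q.frame.toLinearEquiv v) : σ.V) : S →L[ℂ] S) s) = _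
  rw [LinearEquiv.symm_apply_apply]

end Bundle

end Geometry

/-! ### Orthogonal bases and smooth orthonormal frames -/

/-- A basis vector that is isotropic and orthogonal to the other basis vectors would lie in the
radical, so nondegeneracy gives nonzero squares. The basis is padded by zeros to a sequence indexed
by ℕ, the form used for Clifford systems. -/
theorem exists_orthogonal_sequence {V : Type*} [AddCommGroup V] [Module ℝ V]
    [FiniteDimensional ℝ V] (Q : QuadraticForm ℝ V)
    (hQ : (QuadraticMap.polarBilin Q).Nondegenerate) :
    ∃ e : ℕ → V,
      (∀ i < finrank ℝ V, ∀ j < finrank ℝ V, i ≠ j → Q (e i + e j) = Q (e i) + Q (e j)) ∧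
      (∀ i < finrank ℝ V, Q (e i) ≠ 0) ∧
      Submodule.span ℝ (e '' Set.Iio (finrank ℝ V)) = ⊤ := by
  obtain ⟨b, hb⟩ := LinearMap.BilinForm.exists_orthogonal_basis (B := QuadraticMap.polarBilin Q)
    ⟨fun v w => QuadraticMap.polar_comm Q v w⟩
  have hb' : ∀ i j, i ≠ j → QuadraticMap.polar Q (b i) (b j) = 0 := fun i j hij => hb hij
  let e : ℕ → V := fun i => if hi : i < finrank ℝ V then b ⟨i, hi⟩ else 0
  have he : ∀ i (hi : i < finrank ℝ V), e i = b ⟨i, hi⟩ := fun i hi => dif_pos hi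
  refine ⟨e, fun i hi j hj hij => ?_, fun i hi h0 => ?_, ?_⟩
  · have h := hb' ⟨i, hi⟩ ⟨j, hj⟩ (by simpa using hij)
    rw [he i hi, he j hj]
    rw [QuadraticMap.polar] at h
    linarith
  · rw [he i hi] at h0
    refine b.ne_zero ⟨i, hi⟩ (hQ.1 _ fun w => ?_)
    suffices h : QuadraticMap.polarBilin Q (b ⟨i, hi⟩) = 0 by rw [h]; rfl
    refine b.ext fun j => ?_
    rcases eq_or_ne ⟨i, hi⟩ j with rfl | hij
    · change QuadraticMap.polar Q _ _ = 0
      rw [QuadraticMap.polar_self, h0, smul_zero]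
    · exact hb' _ _ hij
  · rw [eq_top_iff, ← b.span_eq]
    refine Submodule.span_mono ?_
    rintro _ ⟨⟨i, hi⟩, rfl⟩
    exact ⟨i, hi, he i hi⟩

section Geometry

variable {E : Type*} [NormedAddCommGroup E] [NormedSpace ℝ E]
  {M : Type*} [TopologicalSpace M] [ChartedSpace E M] [IsManifold 𝓘(ℝ, E) ∞ M]

/-- Every orthonormal frame at a point extends to a smooth orthonormal frame near the point. -/
theorem MetricField.exists_smooth_orthonormal_frame [FiniteDimensional ℝ E] (g : MetricField E M)
    {V : Type*} [AddCommGroup V] [Module ℝ V] {Q : QuadraticForm ℝ V} (x₀ : M)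
    (f : Q.IsometryEquiv (g.quad x₀)) :
    ∃ (U : Set M) (X : ∀ x : M, V →ₗ[ℝ] TangentSpace 𝓘(ℝ, E) x), IsOpen U ∧ x₀ ∈ U ∧
      (∀ v, X x₀ v = f v) ∧ (∀ x ∈ U, ∀ v, g.quad x (X x v) = Q v) ∧
      ∀ v, SmoothField (fun x => X x v) U := by
  let t := trivializationAt E (TangentSpace 𝓘(ℝ, E) : M → Type _) x₀
  have hx₀ : x₀ ∈ t.baseSet := FiberBundle.mem_baseSet_trivializationAt _ _ x₀
  -- The metric in the trivialization t: a smooth family of forms on the fixed space E, to be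
  -- compared with its value at x₀.
  let G : M → E →L[ℝ] E →L[ℝ] ℝ := fun x =>
    ContinuousLinearMap.bilinearComp (show E →L[ℝ] E →L[ℝ] ℝ from g.inner x)
      (show E →L[ℝ] E from t.symmL ℝ x) (show E →L[ℝ] E from t.symmL ℝ x)
  have hG : ∀ x v w, G x v w = g.inner x (t.symmL ℝ x v) (t.symmL ℝ x w) := fun _ _ _ => rfl
  have hconst : ∀ w : E, SmoothField (fun x => t.symmL ℝ x w) t.baseSet := fun w => by
    refine (t.contMDiffOn_section_iff (IB := 𝓘(ℝ, E)) t.open_baseSet subset_rfl).2 ?_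
    refine contMDiffOn_const (c := w) |>.congr fun x hx => ?_
    rw [t.symmL_apply hx, t.apply_mk_symm hx]
  have hGd : ContMDiffOn 𝓘(ℝ, E) 𝓘(ℝ, E →L[ℝ] E →L[ℝ] ℝ) ∞ G t.baseSet := by
    refine contMDiffOn_clm_of_apply fun v => contMDiffOn_clm_of_apply fun w => ?_
    have h := ContMDiffOn.clm_bundle_apply₂ (g.contMDiff.contMDiffOn (s := t.baseSet))
      (hconst v) (hconst w)
    exact fun x hx => (Bundle.contMDiffWithinAt_totalSpace.1 (h x hx)).2
  obtain ⟨N, A, hN, hGN, hA, hA1, hAG⟩ := exists_smooth_orthonormalization (G x₀)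
    (fun v w => g.symm x₀ _ _) (fun v hv => by
      have h1 := g.nondegenerate x₀ (t.symmL ℝ x₀ v) fun w => by
        have h2 := hv (t.continuousLinearMapAt ℝ x₀ w)
        rwa [hG, t.symmL_continuousLinearMapAt hx₀] at h2
      rw [← t.continuousLinearMapAt_symmL (R := ℝ) hx₀ v, h1, map_zero])
  let U : Set M := t.baseSet ∩ G ⁻¹' N
  have hAd : ContMDiffOn 𝓘(ℝ, E) 𝓘(ℝ, E →L[ℝ] E) ∞ (fun x => A (G x)) U :=
    hA.contMDiffOn.comp (hGd.mono Set.inter_subset_left) fun x hx => hx.2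
  -- The frame at x₀ is moved to x by t and corrected by A(G x), which takes G x back to G x₀. At x₀
  -- the correction is 1.
  refine ⟨U, fun x => ((t.symmL ℝ x ∘L A (G x) ∘L t.continuousLinearMapAt ℝ x₀ :
    TangentSpace 𝓘(ℝ, E) x₀ →L[ℝ] TangentSpace 𝓘(ℝ, E) x) :
      TangentSpace 𝓘(ℝ, E) x₀ →ₗ[ℝ] TangentSpace 𝓘(ℝ, E) x) ∘ₗ f.toLinearEquiv.toLinearMap,
    hGd.continuousOn.isOpen_inter_preimage t.open_baseSet hN, ⟨hx₀, hGN⟩, fun v => ?_,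
    fun x hx v => ?_, fun v => ?_⟩
  · change t.symmL ℝ x₀ (A (G x₀) (t.continuousLinearMapAt ℝ x₀ (f v))) = f v
    rw [hA1]
    exact t.symmL_continuousLinearMapAt hx₀ (f v)
  · change g.inner x (t.symmL ℝ x (A (G x) (t.continuousLinearMapAt ℝ x₀ (f v))))
      (t.symmL ℝ x (A (G x) (t.continuousLinearMapAt ℝ x₀ (f v)))) = Q v
    rw [← hG, hAG _ hx.2 fun v w => g.symm x _ _, hG, t.symmL_continuousLinearMapAt hx₀,
      ← MetricField.quad_apply, f.map_app]
  · refine (t.contMDiffOn_section_iff (IB := 𝓘(ℝ, E))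
      (hGd.continuousOn.isOpen_inter_preimage t.open_baseSet hN) Set.inter_subset_left).2 ?_
    refine (hAd.clm_apply (contMDiffOn_const (c := t.continuousLinearMapAt ℝ x₀ (f v)))).congr
      fun x hx => ?_
    change (t ⟨x, t.symmL ℝ x (A (G x) (t.continuousLinearMapAt ℝ x₀ (f v)))⟩).2 = _
    rw [t.symmL_apply hx.1, t.apply_mk_symm hx.1]

/-! ### Existence of smooth families of spin space isomorphisms -/

variable {F : Type*} [NormedAddCommGroup F] [NormedSpace ℂ F]
  {Sig : M → Type*} [∀ x, AddCommGroup (Sig x)] [∀ x, Module ℂ (Sig x)]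
  [∀ x, TopologicalSpace (Sig x)] [TopologicalSpace (TotalSpace F Sig)] [FiberBundle F Sig]
  {g : MetricField E M} {τ : CliffordModuleBundle F Sig g}
  {S : Type*} [NormedAddCommGroup S] [NormedSpace ℂ S] {σ : SpinSpace S}

theorem SpinSpace.finiteDimensional_vectors (σ : SpinSpace S) : FiniteDimensional ℝ σ.V :=
  have := σ.finiteDimensional
  have : FiniteDimensional ℝ (S →L[ℂ] S) := Module.Finite.trans ℂ _
  inferInstance

theorem SpinSpace.evaluationRep_ι (σ : SpinSpace S) (v : σ.V) (s : S) :
    evaluationRep σ.V σ.h σ.sq_eq (CliffordAlgebra.ι σ.h v) s = (v : S →L[ℂ] S) s := by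
  rw [evaluationRep, CliffordAlgebra.lift_ι_apply]
  rfl

/-- A linear isomorphism that intertwines vectors and tangent vectors along a surjective map is an
isomorphism of spin spaces. -/
def SpinIso.ofIntertwiner {x : M} (q : S ≃ₗ[ℂ] Sig x) (f : σ.V → TangentSpace 𝓘(ℝ, E) x)
    (hf : Function.Surjective f)
    (hq : ∀ v s, τ.clifford x (f v) (q s) = q ((v : S →L[ℂ] S) s)) : SpinIso σ τ x :=
  ⟨q, by
    have h : ∀ v : σ.V, q.conj ((v : S →L[ℂ] S) : S →ₗ[ℂ] S) = τ.clifford x (f v) := fun v => by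
      ext w
      obtain ⟨s, rfl⟩ := q.surjective w
      rw [hq]
      simp [LinearEquiv.conj_apply]
    rw [funext h]
    exact hf.range_comp (τ.clifford x)⟩

/-- It suffices to check that a linear map intertwines vectors on a spanning set. -/
theorem clifford_intertwines_of_span {x : M} (q : S →ₗ[ℂ] Sig x)
    (f : σ.V →ₗ[ℝ] TangentSpace 𝓘(ℝ, E) x) {B : Set σ.V} (hB : Submodule.span ℝ B = ⊤)
    (hq : ∀ v ∈ B, ∀ s, τ.clifford x (f v) (q s) = q ((v : S →L[ℂ] S) s)) (v : σ.V) (s : S) :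
    τ.clifford x (f v) (q s) = q ((v : S →L[ℂ] S) s) := by
  have hv : v ∈ Submodule.span ℝ B := hB ▸ Submodule.mem_top
  induction hv using Submodule.span_induction with
  | mem v hv => exact hq v hv s
  | zero => simp [CliffordModuleBundle.clifford]
  | add v w _ _ hv hw =>
    rw [map_add, CliffordModuleBundle.clifford_add, LinearMap.add_apply, hv, hw, ← map_add]
    rfl
  | smul c v _ hv =>
    rw [map_smul, CliffordModuleBundle.clifford_smul, LinearMap.smul_apply, hv]
    exact (q.map_smul_of_tower c _).symm

/-- Over a point, an orthonormal frame lifts to an isomorphism of the spin space with the fibre of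
the spinor bundle. -/
theorem exists_intertwiner (hspinor : τ.IsSpinorBundle) (x : M)
    (hrank : finrank ℂ (Sig x) = 2 ^ nu (finrank ℝ E)) (f : σ.h.IsometryEquiv (g.quad x)) :
    ∃ q : S ≃ₗ[ℂ] Sig x, ∀ v s, τ.clifford x (f v) (q s) = q ((v : S →L[ℂ] S) s) := by
  have := σ.finiteDimensional_vectors
  obtain ⟨e, he, he0, hspan⟩ := exists_orthogonal_sequence σ.h σ.nondegenerate
  obtain ⟨q, hq⟩ := σ.isSpinor.exists_intertwiner (hspinor x) σ.finrank_eq hrank f e he he0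
  refine ⟨q, clifford_intertwines_of_span q.toLinearMap f.toLinearEquiv.toLinearMap hspan ?_⟩
  rintro _ ⟨i, hi, rfl⟩ s
  have h := hq i hi s
  rw [σ.evaluationRep_ι] at h
  exact h.symm

/-- In a trivialization of Σ, a smooth orthonormal frame acts by a smooth family of Clifford systems
on F, with squares independent of the point. The lift at x₀, extended as a constant map and then
averaged, is a smooth family of intertwiners that is invertible at x₀, hence nearby. -/
theorem hasSmoothSpinFrames [FiniteDimensional ℝ E] [VectorBundle ℂ F Sig]
    [ContMDiffVectorBundle ∞ F Sig 𝓘(ℝ, E)] (hspinor : τ.IsSpinorBundle) (hrank : finrank ℂ F = 2 ^ nu (finrank ℝ E))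
    (hmodel : ∀ x, Nonempty (σ.h.IsometryEquiv (g.quad x))) : HasSmoothSpinFrames σ τ := by
  have := σ.finiteDimensional
  have := σ.finiteDimensional_vectors
  have : FiniteDimensional ℂ F := Module.finite_of_finrank_pos (by rw [hrank]; positivity)
  have : CompleteSpace S := FiniteDimensional.complete ℂ S
  have hrank' : ∀ x, finrank ℂ (Sig x) = 2 ^ nu (finrank ℝ E) := fun x => by
    rw [← hrank]
    exact ((trivializationAt F Sig x).linearEquivAt ℂ x
      (FiberBundle.mem_baseSet_trivializationAt F Sig x)).finrank_eq
  -- A smooth family is a function on all of M; these elements fill in its values outside the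
  -- neighbourhood.
  have hne : ∀ x, Nonempty (SpinIso σ τ x) := fun x => by
    obtain ⟨f⟩ := hmodel x
    obtain ⟨q, hq⟩ := exists_intertwiner hspinor x (hrank' x) f
    exact ⟨SpinIso.ofIntertwiner q f f.toLinearEquiv.surjective hq⟩
  refine ⟨fun x₀ => ?_⟩
  obtain ⟨f⟩ := hmodel x₀
  obtain ⟨U₁, X, hU₁, hx₁, hX₀, hXQ, hXs⟩ := g.exists_smooth_orthonormal_frame x₀ f
  obtain ⟨q₀, hq₀⟩ := exists_intertwiner hspinor x₀ (hrank' x₀) f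
  obtain ⟨e, he, he0, hspan⟩ := exists_orthogonal_sequence σ.h σ.nondegenerate
  let t := trivializationAt F Sig x₀
  have hx₀ : x₀ ∈ t.baseSet := FiberBundle.mem_baseSet_trivializationAt F Sig x₀
  have hlin : ∀ x ∈ t.baseSet, ∀ z : Sig x, t.linearMapAt ℂ x z = (t ⟨x, z⟩).2 :=
    fun x hx z => by rw [t.coe_linearMapAt_of_mem hx]
  have htt : ∀ x ∈ t.baseSet, ∀ z : Sig x, t.symmₗ ℂ x (t ⟨x, z⟩).2 = z := fun x hx z => by
    rw [← hlin x hx]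
    exact t.symmₗ_linearMapAt hx z
  have htt' : ∀ x ∈ t.baseSet, ∀ w : F, (t ⟨x, t.symmₗ ℂ x w⟩).2 = w := fun x hx w => by
    rw [← hlin x hx]
    exact t.linearMapAt_symmₗ hx w
  let a : σ.V → S →L[ℂ] S := fun v => v
  let b : M → σ.V → F →L[ℂ] F := fun x v => LinearMap.toContinuousLinearMap
    (t.linearMapAt ℂ x ∘ₗ τ.clifford x (X x v) ∘ₗ t.symmₗ ℂ x)
  have hb : ∀ x ∈ t.baseSet, ∀ v w, b x v w = (t ⟨x, τ.clifford x (X x v) (t.symmₗ ℂ x w)⟩).2 :=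
    fun x hx v w => by
      change t.linearMapAt ℂ x _ = _
      rw [hlin x hx]
      rfl
  have hbd : ∀ v, ContMDiffOn 𝓘(ℝ, E) 𝓘(ℝ, F →L[ℂ] F) ∞ (fun x => b x v) (U₁ ∩ t.baseSet) := by
    refine fun v => contMDiffOn_clm_of_apply fun w => ?_
    have h1 : SmoothSection E F (fun x => t.symmₗ ℂ x w) (U₁ ∩ t.baseSet) := by
      refine (t.contMDiffOn_section_iff (IB := 𝓘(ℝ, E)) (n := ∞) (hU₁.inter t.open_baseSet)
        Set.inter_subset_right).2 ?_
      exact (contMDiffOn_const (c := w)).congr fun x hx => htt' x hx.2 w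
    have h2 := τ.smooth _ (hU₁.inter t.open_baseSet) (fun x => X x v) _
      ((hXs v).mono Set.inter_subset_left) h1
    exact ((t.contMDiffOn_section_iff (IB := 𝓘(ℝ, E)) (n := ∞) (hU₁.inter t.open_baseSet)
      Set.inter_subset_right).1 h2).congr fun x hx => hb x hx.2 v w
  let c : ℕ → ℂ := fun i => (σ.h (e i) : ℂ)
  have hc : ∀ i < finrank ℝ σ.V, c i ≠ 0 := fun i hi => by simpa [c] using he0 i hi
  have hA : IsCliffordSystem (finrank ℝ σ.V) c (fun i => a (e i)) :=
    isCliffordSystem_ι a (fun _ _ => rfl) (fun v => by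
      rw [σ.sq_eq v, Algebra.algebraMap_eq_smul_one]
      ext s
      simp) he
  have hB : ∀ x ∈ U₁ ∩ t.baseSet,
      IsCliffordSystem (finrank ℝ σ.V) c (fun i => b x (e i)) := fun x hx =>
    isCliffordSystem_ι (b x) (fun v w => by
      ext z
      simp [b, CliffordModuleBundle.clifford_add]) (fun v => by
      ext w
      rw [mul_apply_eq_comp, hb x hx.2, hb x hx.2, htt x hx.2, ← Module.End.mul_apply,
        CliffordModuleBundle.clifford_mul_self, hXQ x hx.1, Module.algebraMap_end_apply,
        ← hlin x hx.2, LinearMap.map_smul_of_tower, hlin x hx.2, htt' x hx.2, Algebra.algebraMap_eq_smul_one]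
      simp) he
  let T₀ : S →L[ℂ] F := LinearMap.toContinuousLinearMap (t.linearMapAt ℂ x₀ ∘ₗ q₀.toLinearMap)
  have hT₀ : ∀ s, T₀ s = (t ⟨x₀, q₀ s⟩).2 := fun s => hlin x₀ hx₀ _
  -- The average runs over the m vectors only. For odd m the auxiliary involution was needed to
  -- obtain q₀, but it need not be extended to nearby points.
  let T : M → S →L[ℂ] F := fun x =>
    average c (fun i => a (e i)) (fun i => b x (e i)) T₀ (finrank ℝ σ.V)
  have hTd : ContMDiffOn 𝓘(ℝ, E) 𝓘(ℝ, S →L[ℂ] F) ∞ T (U₁ ∩ t.baseSet) :=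
    contMDiffOn_average T₀ _ fun i _ => hbd (e i)
  have hT₁ : T x₀ = T₀ := average_eq_self hA hc fun i _ => by
    ext s
    rw [ContinuousLinearMap.comp_apply, ContinuousLinearMap.comp_apply, hT₀, hb _ hx₀,
      htt x₀ hx₀, hX₀, hq₀, hT₀]
  have hTi : ∀ x ∈ U₁ ∩ t.baseSet, ∀ i < finrank ℝ σ.V, ∀ s,
      b x (e i) (T x s) = T x (a (e i) s) := fun x hx i hi s =>
    DFunLike.congr_fun (average_intertwines (T := T₀) hA (hB x hx) hc i hi) s
  let U : Set M := (U₁ ∩ t.baseSet) ∩ T ⁻¹' Set.range ((↑) : (S ≃L[ℂ] F) → S →L[ℂ] F)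
  have hU : IsOpen U := hTd.continuousOn.isOpen_inter_preimage (hU₁.inter t.open_baseSet)
    ContinuousLinearEquiv.isOpen
  have hx₀U : x₀ ∈ U := by
    refine ⟨⟨hx₁, hx₀⟩, (q₀.trans (t.linearEquivAt ℂ x₀ hx₀)).toContinuousLinearEquiv, ?_⟩
    rw [hT₁]
    ext s
    rw [hT₀]
    rfl
  have hspin : ∀ x, ∃ q : SpinIso σ τ x, x ∈ U →
      (∀ s, (t ⟨x, q.1 s⟩).2 = T x s) ∧ ∀ v, q.frame v = X x v := by
    intro x
    by_cases hx : x ∈ U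
    · obtain ⟨A, hAx⟩ := hx.2
      let q : S ≃ₗ[ℂ] Sig x := A.toLinearEquiv.trans (t.linearEquivAt ℂ x hx.1.2).symm
      have hqT : ∀ s, (t ⟨x, q s⟩).2 = T x s := fun s => by
        rw [← hAx]
        exact (t.linearEquivAt ℂ x hx.1.2).apply_symm_apply (A s)
      have hqs : ∀ s, q s = t.symmₗ ℂ x (T x s) := fun s => by rw [← hqT, htt x hx.1.2]
      have hq := clifford_intertwines_of_span (τ := τ) q.toLinearMap (X x) hspan (by
        rintro _ ⟨i, hi, rfl⟩ s
        change τ.clifford x (X x (e i)) (q s) = q (a (e i) s)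
        rw [hqs (a (e i) s), ← hTi x hx.1 i hi, hb x hx.1.2, htt x hx.1.2, hqs])
      -- X x v determines q v q⁻¹ and therefore v, so X x is injective; equality of dimensions gives
      -- surjectivity.
      have hXsurj : Function.Surjective (X x) := by
        have hfr : finrank ℝ σ.V = finrank ℝ (TangentSpace 𝓘(ℝ, E) x) :=
          (Classical.choice (hmodel x)).toLinearEquiv.finrank_eq
        have : FiniteDimensional ℝ (TangentSpace 𝓘(ℝ, E) x) := inferInstanceAs
          (FiniteDimensional ℝ E)
        refine (LinearMap.injective_iff_surjective_of_finrank_eq_finrank hfr).1 ?_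
        intro v w hvw
        ext s
        apply q.injective
        have h1 := hq v s
        have h2 := hq w s
        rw [hvw] at h1
        exact h1.symm.trans h2
      refine ⟨SpinIso.ofIntertwiner q (X x) hXsurj hq, fun _ => ⟨hqT, fun v => ?_⟩⟩
      exact SpinIso.vector_eq _ fun s => hq v s
    · exact ⟨Classical.choice (hne x), fun h => absurd h hx⟩
  choose spin hspin using hspin
  refine ⟨⟨U, hU, spin, fun s => ?_, fun v => ?_⟩, hx₀U⟩
  · refine (t.contMDiffOn_section_iff (IB := 𝓘(ℝ, E)) (n := ∞) hU fun x hx => hx.1.2).2 ?_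
    exact (contMDiffOn_clm_apply_complex (hTd.mono Set.inter_subset_left)
      (contMDiffOn_const (c := s))).congr fun x hx => (hspin x hx).1 s
  · exact ((hXs v).mono fun x hx => hx.1.1).congr fun x hx => by
      simp only [(hspin x hx).2 v]

end Geometry

end SpinorBundles

end

/-! ### The theorem on spinor bundles and lpin structures -/

theorem mainTheorem2 {E : Type*} [NormedAddCommGroup E] [NormedSpace ℝ E] [FiniteDimensional ℝ E]
    {M : Type*} [TopologicalSpace M] [ChartedSpace E M] [IsManifold 𝓘(ℝ, E) ∞ M]
    (g : MetricField E M)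
    {F : Type*} [NormedAddCommGroup F] [NormedSpace ℂ F]
    {Sig : M → Type*} [∀ x, AddCommGroup (Sig x)] [∀ x, Module ℂ (Sig x)]
    [∀ x, TopologicalSpace (Sig x)] [TopologicalSpace (TotalSpace F Sig)] [FiberBundle F Sig]
    [VectorBundle ℂ F Sig] [ContMDiffVectorBundle ∞ F Sig 𝓘(ℝ, E)]
    (τ : CliffordModuleBundle F Sig g)
    (hspinor : τ.IsSpinorBundle) (hfaithful : τ.IsFaithful)
    (hrank : Module.finrank ℂ F = 2 ^ nu (Module.finrank ℝ E))
    {S : Type*} [NormedAddCommGroup S] [NormedSpace ℂ S]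
    (σ : SpinSpace S)
    (hmodel : ∀ x, Nonempty (σ.h.IsometryEquiv (g.quad x))) :
    ∃ (_ : TopologicalSpace (TotalSpace σ.Lpin (SpinIso σ τ)))
      (_ : ∀ x, TopologicalSpace (SpinIso σ τ x))
      (_ : FiberBundle σ.Lpin (SpinIso σ τ))
      (_ : IsPrincipalBundle σ.Lpin (SpinIso σ τ))
      (L : LpinStructure σ g (SpinIso σ τ))
      (Φ : SmoothBundleIso (E := E) S (AssocBundle σ.Lpin (SpinIso σ τ)) F Sig),
      (∀ (x : M) (q : SpinIso σ τ x) (v : σ.V),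
        τ.clifford x (L.χ x q v) = q.1.conj ((v : S →L[ℂ] S) : S →ₗ[ℂ] S)) ∧
      (∀ (x : M) (q : SpinIso σ τ x) (s : S), Φ.equiv x (AssocBundle.mk q s) = q.1 s) ∧
      (∀ (x : M) (X : TangentSpace 𝓘(ℝ, E) x) (z : AssocBundle σ.Lpin (SpinIso σ τ) x),
        Φ.equiv x (L.clifford x X z) = τ.clifford x X (Φ.equiv x z)) := by
  have := hasSmoothSpinFrames (τ := τ) (σ := σ) hspinor hrank hmodel
  exact ⟨inferInstance, inferInstance, inferInstance, inferInstance, lpinStructure σ τ,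
    assocIso σ τ, fun _ q v => q.clifford_vector v, fun _ q s => assocEquiv_mk q s,
    fun _ X z => assocEquiv_clifford X z⟩
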